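/- **Setting.** Consider classical two-sorted first-order logic with equality, with a sort $B$ of bodies and a sort $Q$ of quantities, over the language $\{IOb,Ph,+,\cdot,\le,W\}$: $IOb,Ph$ are unary relations on $B$, $+,\cdot$ are binary operations and $\le$ a binary relation on $Q$, and $W$ is a relation on $B^2\times Q^4$. Write $\bar x=\langle x_0,x_1,x_2,x_3\rangle\in Q^4$, $\;\bar x\in wl_k(b)\Leftrightarrow W(k,b,\bar x)$, $\;ev_k(\bar x)=\{b: W(k,b,\bar x)\}$, $\;space(\bar x,\bar y)=\sqrt{\sum_{i=1}^3(x_i-y_i)^2}$, $\;time(\bar x,\bar y)=|x_0-y_0|$ (abbreviations, expressible in the language). Variables $k,k',h$ below range over $IOb$, variables $p$ over $Ph$, and $\bar x,\bar y,\bar z,\bar x',\bar y'$ over $Q^4$. $\mathsf{Kin_{Full}}$ consists of: - AxEField: $\langle Q,+,\cdot,\le\rangle$ is an ordered field in which every positive element has a square root; - AxEv: $\forall k,h\,\forall\bar x\,\exists\bar y\;\; ev_k(\bar x)=ev_h(\bar y)$; - AxSelf: $\forall k\,\forall \bar x\;\,(W(k,k,\bar x)\leftrightarrow x_1=x_2=x_3=0)$;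 - AxSymD: if $time(\bar x,\bar y)=time(\bar x',\bar y')=0$, $ev_k(\bar x)=ev_{k'}(\bar x')$ and $ev_k(\bar y)=ev_{k'}(\bar y')$, then $space(\bar x,\bar y)=space(\bar x',\bar y')$; - AxLine: if $\bar x,\bar y,\bar z\in wl_k(h)$, then there is $a\in Q$ with $\bar z-\bar x=a(\bar y-\bar x)$ or $\bar y-\bar z=a(\bar z-\bar x)$; - AxTriv: for every trivial transformation $T$ of $Q^4$ (an isometry of space composed with a translation of time) and every $k$ there is $k'$ such that for all $\bar x,\bar y$: $ev_k(\bar x)=ev_{k'}(\bar y)\leftrightarrow \bar y=T(\bar x)$; - AxNoAcc: every body $k$ with $W(k,b,\bar x)$ for some $b,\bar x$ satisfies $IOb(k)$. $\mathsf{ClassicalKin_{Full}}$ is $\mathsf{Kin_{Full}}$ together with: - AxAbsTime: if $ev_k(\bar x)=ev_{k'}(\bar x')$ and $ev_k(\bar y)=ev_{k'}(\bar y')$, then $time(\bar x,\bar y)=time(\bar x',\bar y')$; - AxThExp$_+$: some inertial observer exists, and for all $k$ and all $\bar x,\bar y$ with $x_0\ne y_0$ there is $k'$ with $\bar x,\bar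 y\in wl_k(k')$; - AxEther: there are $e\in IOb$ and $c>0$ such that for all $\bar x,\bar y$: $\exists p\,(\bar x,\bar y\in wl_e(p))\leftrightarrow space(\bar x,\bar y)=c\cdot time(\bar x,\bar y)$. $\mathsf{SpecRel_{Full}}$ is $\mathsf{Kin_{Full}}$ together with: - AxPh$_c$: there is $c>0$ such that for all $k$ and all $\bar x,\bar y$: $\exists p\,(\bar x,\bar y\in wl_k(p))\leftrightarrow space(\bar x,\bar y)=c\cdot time(\bar x,\bar y)$; - AxThExp: some inertial observer exists, and for all $k$ and all $\bar x,\bar y$ with $space(\bar x,\bar y)<\mathfrak c\cdot time(\bar x,\bar y)$, where $\mathfrak c$ is the speed of light given by AxPh$_c$, there is $k'$ with $\bar x,\bar y\in wl_k(k')$. A *translation* $Tr$ of the language into itself assigns to every $n$-ary relation symbol $R$ a formula $\varphi_R(x_1,\dots,x_n)$ whose free variables are among $x_1,\dots,x_n$, of the corresponding sorts (the operations $+,\cdot$ are treated as the ternary relations $x+y=z$ and $x\cdot y=z$), and is extended to all formulas by $Tr(R(x_1,\dots,x_n))=\varphi_R(x_1,\dots,x_n)$, preserving the equality, the connectives, and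 the quantifiers of both sorts (compound terms are first eliminated by existential quantifiers). $Tr$ is an *interpretation* of a theory $\mathsf{Th}_1$ in a theory $\mathsf{Th}_2$ if $\mathsf{Th}_1\vdash\varphi$ implies $\mathsf{Th}_2\vdash Tr(\varphi)$ for every formula $\varphi$. **Theorem.** There is no interpretation of $\mathsf{ClassicalKin_{Full}}$ in $\mathsf{SpecRel_{Full}}$. -/

import Mathlib

namespace Kinematics

/-! ## Two-sorted first-order logic over the language `B, Q; IOb, Ph, +, ·, ≤, W`

The two sorts are *bodies* and *quantities*. Variables of each sort are de Bruijn indices, counted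
separately for the two sorts, so formulas are identified up to renaming of bound variables.
Free variables are the natural numbers of each sort. -/

/-- Quantity terms. (Body terms are just body variables, i.e. natural numbers.) -/
inductive QTerm : Type
  | var (n : ℕ)
  | add (s t : QTerm)
  | mul (s t : QTerm)

/-- Formulas; `allB` and `allQ` bind the variable `0` of sort body and quantity, respectively. -/
inductive Fm : Type
  | iob (k : ℕ)
  | ph (p : ℕ)
  | wv (k b : ℕ) (x : Fin 4 → QTerm)
  | le (s t : QTerm)
  | eqQ (s t : QTerm)
  | eqB (k b : ℕ)
  | neg (φ : Fm)
  | imp (φ ψ : Fm)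
  | allB (φ : Fm)
  | allQ (φ : Fm)

/-- Simultaneous substitution in a term. -/
def QTerm.subst (σ : ℕ → QTerm) : QTerm → QTerm
  | .var n => σ n
  | .add s t => .add (s.subst σ) (t.subst σ)
  | .mul s t => .mul (s.subst σ) (t.subst σ)

/-- Renumber the quantity variables of a term for use below `d` further quantity binders. -/
def QTerm.up (d : ℕ) (t : QTerm) : QTerm := t.subst (fun n => .var (n + d))

/-- Extend a renaming of body variables below a body binder. -/
def liftB (β : ℕ → ℕ) : ℕ → ℕ
  | 0 => 0
  | n + 1 => β n + 1

/-- Extend a substitution for quantity variables below a quantity binder. -/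
def liftQ (σ : ℕ → QTerm) : ℕ → QTerm
  | 0 => .var 0
  | n + 1 => (σ n).up 1

/-- Simultaneous capture-avoiding substitution for the free variables of both sorts. -/
def Fm.subst : Fm → (ℕ → ℕ) → (ℕ → QTerm) → Fm
  | .iob k, β, _ => .iob (β k)
  | .ph p, β, _ => .ph (β p)
  | .wv k b x, β, σ => .wv (β k) (β b) (fun i => (x i).subst σ)
  | .le s t, _, σ => .le (s.subst σ) (t.subst σ)
  | .eqQ s t, _, σ => .eqQ (s.subst σ) (t.subst σ)
  | .eqB k b, β, _ => .eqB (β k) (β b)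
  | .neg φ, β, σ => .neg (φ.subst β σ)
  | .imp φ ψ, β, σ => .imp (φ.subst β σ) (ψ.subst β σ)
  | .allB φ, β, σ => .allB (φ.subst (liftB β) σ)
  | .allQ φ, β, σ => .allQ (φ.subst β (liftQ σ))

/-- `φ` regarded below a new body binder, whose variable does not occur in it. -/
def Fm.shiftB (φ : Fm) : Fm := φ.subst Nat.succ .var

/-- `φ` regarded below a new quantity binder, whose variable does not occur in it. -/
def Fm.shiftQ (φ : Fm) : Fm := φ.subst id (fun n => .var (n + 1))

/-- The substitution putting the body variable `b` for the variable bound by a removed `allB`. -/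
def Fm.instB (φ : Fm) (b : ℕ) : Fm :=
  φ.subst (fun n => match n with | 0 => b | m + 1 => m) .var

/-- The substitution putting the term `t` for the variable bound by a removed `allQ`. -/
def Fm.instQ (φ : Fm) (t : QTerm) : Fm :=
  φ.subst id (fun n => match n with | 0 => t | m + 1 => .var m)

/-- All variables of the term are among the quantity variables `0, …, n - 1`. -/
def QTerm.VarsBelow (n : ℕ) : QTerm → Prop
  | .var i => i < n
  | .add s t => s.VarsBelow n ∧ t.VarsBelow n
  | .mul s t => s.VarsBelow n ∧ t.VarsBelow n

/-- All free variables of the formula are among the body variables `0, …, m - 1` and the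
quantity variables `0, …, n - 1`. -/
def Fm.FreeBelow : Fm → ℕ → ℕ → Prop
  | .iob k, m, _ => k < m
  | .ph p, m, _ => p < m
  | .wv k b x, m, n => k < m ∧ b < m ∧ ∀ i, (x i).VarsBelow n
  | .le s t, _, n => s.VarsBelow n ∧ t.VarsBelow n
  | .eqQ s t, _, n => s.VarsBelow n ∧ t.VarsBelow n
  | .eqB k b, m, _ => k < m ∧ b < m
  | .neg φ, m, n => φ.FreeBelow m n
  | .imp φ ψ, m, n => φ.FreeBelow m n ∧ ψ.FreeBelow m n
  | .allB φ, m, n => φ.FreeBelow (m + 1) n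
  | .allQ φ, m, n => φ.FreeBelow m (n + 1)

/-! ### Further connectives and quantifiers -/

def Fm.and (φ ψ : Fm) : Fm := .neg (.imp φ (.neg ψ))
def Fm.or (φ ψ : Fm) : Fm := .imp (.neg φ) ψ
def Fm.iff (φ ψ : Fm) : Fm := .and (.imp φ ψ) (.imp ψ φ)
def Fm.exB (φ : Fm) : Fm := .neg (.allB (.neg φ))
def Fm.exQ (φ : Fm) : Fm := .neg (.allQ (.neg φ))

infixr:55 "⋏" => Fm.and
infixr:54 "⋎" => Fm.or
infixr:53 "⇛" => Fm.imp
infix:52 "⇚⇛" => Fm.iff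
infix:60 "≐" => Fm.eqQ
infixl:65 "⊹" => QTerm.add
infixl:70 "⊡" => QTerm.mul

/-! ### Deducibility -/

/-- Propositional tautologies: true under every truth assignment to formulas that respects the
connectives. -/
def Fm.IsTautology (φ : Fm) : Prop :=
  ∀ v : Fm → Prop, (∀ ψ, v (.neg ψ) ↔ ¬ v ψ) → (∀ ψ χ, v (.imp ψ χ) ↔ (v ψ → v χ)) → v φ

/-- `T ⊢ φ` for a set `T` of sentences: the usual Hilbert calculus of classical first-order logic
with equality, with the rules of detachment and generalization. -/
inductive Proves (T : Set Fm) : Fm → Prop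
  | ax {φ : Fm} : φ ∈ T → Proves T φ
  | taut {φ : Fm} : φ.IsTautology → Proves T φ
  | allB_imp (φ ψ : Fm) : Proves T (.allB (φ.shiftB ⇛ ψ) ⇛ φ ⇛ .allB ψ)
  | allQ_imp (φ ψ : Fm) : Proves T (.allQ (φ.shiftQ ⇛ ψ) ⇛ φ ⇛ .allQ ψ)
  | allB_inst (φ : Fm) (b : ℕ) : Proves T (.allB φ ⇛ φ.instB b)
  | allQ_inst (φ : Fm) (t : QTerm) : Proves T (.allQ φ ⇛ φ.instQ t)
  | eqB_refl (b : ℕ) : Proves T (.eqB b b)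
  | eqQ_refl (t : QTerm) : Proves T (t ≐ t)
  | eqB_subst (φ : Fm) (b b' : ℕ) : Proves T (.eqB b b' ⇛ φ.instB b ⇛ φ.instB b')
  | eqQ_subst (φ : Fm) (t t' : QTerm) : Proves T (t ≐ t' ⇛ φ.instQ t ⇛ φ.instQ t')
  | mp {φ ψ : Fm} : Proves T (φ ⇛ ψ) → Proves T φ → Proves T ψ
  | genB {φ : Fm} : Proves T φ → Proves T (.allB φ)
  | genQ {φ : Fm} : Proves T φ → Proves T (.allQ φ)

/-! ### Translations and interpretations -/

/-- The substitution `0 ↦ l₀, 1 ↦ l₁, …` of quantity variables for quantity variables. -/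
def vars (l : List ℕ) : ℕ → QTerm := fun n => .var (l.getD n 0)

/-- The data of a translation of the language into itself: for every `n`-ary relation symbol a
formula with free variables (at most) the first `n` variables of the corresponding sorts. The
operations are treated as the ternary relations `v₀ + v₁ = v₂` and `v₀ · v₁ = v₂`. -/
structure Translation where
  iob : Fm
  ph : Fm
  wv : Fm
  le : Fm
  add : Fm
  mul : Fm
  iob_free : iob.FreeBelow 1 0
  ph_free : ph.FreeBelow 1 0
  wv_free : wv.FreeBelow 2 4
  le_free : le.FreeBelow 0 2
  add_free : add.FreeBelow 0 3
  mul_free : mul.FreeBelow 0 3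

/-- Given a formula `γ` about the value `0` of a term with variables `m` renamed to `m + 1`, move
it below binders: the value becomes `j`, and the variable `m` of the term becomes `m + d`. -/
def placeVal (γ : Fm) (j d : ℕ) : Fm :=
  γ.subst id (fun n => match n with | 0 => .var j | m + 1 => .var (m + d))

/-- The translation of `t = v`, where `v` is the variable `0` and every variable `m` of `t` is
renamed to `m + 1`. A compound term is unnested: `s + t = v` is read as
`∃ a b, s = a ∧ t = b ∧ a + b = v`. -/
def Translation.graph (T : Translation) : QTerm → Fm
  | .var m => .var (m + 1) ≐ .var 0
  | .add s t => .exQ (.exQ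
      (placeVal (T.graph s) 1 3 ⋏ placeVal (T.graph t) 0 3 ⋏ T.add.subst id (vars [1, 0, 2])))
  | .mul s t => .exQ (.exQ
      (placeVal (T.graph s) 1 3 ⋏ placeVal (T.graph t) 0 3 ⋏ T.mul.subst id (vars [1, 0, 2])))

/-- The translation of formulas: equality (between variables), connectives and quantifiers are
preserved, relation symbols are replaced by their formulas. Quantity terms in the arguments are
unnested, `R(t₁, …, tₙ)` being read as `∃ v₁ … vₙ, t₁ = v₁ ∧ … ∧ tₙ = vₙ ∧ R(v₁, …, vₙ)`. -/
def Translation.tr (T : Translation) : Fm → Fm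
  | .iob k => T.iob.subst (fun _ => k) .var
  | .ph p => T.ph.subst (fun _ => p) .var
  | .wv k b x => .exQ (.exQ (.exQ (.exQ
      (placeVal (T.graph (x 0)) 3 4 ⋏ placeVal (T.graph (x 1)) 2 4 ⋏
       placeVal (T.graph (x 2)) 1 4 ⋏ placeVal (T.graph (x 3)) 0 4 ⋏
       T.wv.subst (fun n => [k, b].getD n 0) (vars [3, 2, 1, 0])))))
  | .le s t => .exQ (.exQ
      (placeVal (T.graph s) 1 2 ⋏ placeVal (T.graph t) 0 2 ⋏ T.le.subst id (vars [1, 0])))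
  | .eqQ (.var i) (.var j) => .var i ≐ .var j
  | .eqQ s t => .exQ (T.graph s ⋏ T.graph t)
  | .eqB k b => .eqB k b
  | .neg φ => .neg (T.tr φ)
  | .imp φ ψ => .imp (T.tr φ) (T.tr ψ)
  | .allB φ => .allB (T.tr φ)
  | .allQ φ => .allQ (T.tr φ)

/-- `T` is an interpretation of the theory `Th₁` in the theory `Th₂`. -/
def IsInterpretation (T : Translation) (Th₁ Th₂ : Set Fm) : Prop :=
  ∀ φ : Fm, Proves Th₁ φ → Proves Th₂ (T.tr φ)

/-! ## Defined notions of kinematics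

The quantifiers `∀ᴮ v, φ`, `∃ᴮ v, φ`, `∀ᴽ v, φ`, `∃ᴽ v, φ` bind the *free* variable `v` of `φ` (of sort
body, body, quantity, quantity), all other free variables keeping their names. -/

def Fm.bindB (v : ℕ) (φ : Fm) : Fm := φ.subst (fun n => if n = v then 0 else n + 1) .var
def Fm.bindQ (v : ℕ) (φ : Fm) : Fm := φ.subst id (fun n => if n = v then .var 0 else .var (n + 1))

notation:56 "∀ᴮ" v:max "," φ:50 => Fm.allB (Fm.bindB v φ)
notation:56 "∃ᴮ" v:max "," φ:50 => Fm.exB (Fm.bindB v φ)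
notation:56 "∀ᴽ" v:max "," φ:50 => Fm.allQ (Fm.bindQ v φ)
notation:56 "∃ᴽ" v:max "," φ:50 => Fm.exQ (Fm.bindQ v φ)

/-- Universal quantification over all quantity variables in a list. -/
def allQs (l : List ℕ) (φ : Fm) : Fm := l.foldr (fun v ψ => ∀ᴽ v, ψ) φ

/-- Existential quantification over all quantity variables in a list. -/
def exQs (l : List ℕ) (φ : Fm) : Fm := l.foldr (fun v ψ => ∃ᴽ v, ψ) φ

/-- A coordinate point `⟨x₀, x₁, x₂, x₃⟩`, made of quantity terms. -/
abbrev Pt : Type := Fin 4 → QTerm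

def Pt.up (d : ℕ) (x : Pt) : Pt := fun i => (x i).up d

/-- The coordinate point made of the variables `n, n + 1, n + 2, n + 3`. -/
def pt (n : ℕ) : Pt := fun i => .var (n + i)

/-- The list of variables of `pt n`. -/
def ptVars (n : ℕ) : List ℕ := [n, n + 1, n + 2, n + 3]

/-- `t = 0`. -/
def isZero (t : QTerm) : Fm := .allQ (.var 0 ⊹ t.up 1 ≐ .var 0)

/-- `s < t`. -/
def lt (s t : QTerm) : Fm := .le s t ⋏ .neg (s ≐ t)

/-- `0 ≤ t`. -/
def nonneg (t : QTerm) : Fm := .exQ (isZero (.var 0) ⋏ .le (.var 0) (t.up 1))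

/-- `0 < t`. -/
def pos (t : QTerm) : Fm := .exQ (isZero (.var 0) ⋏ lt (.var 0) (t.up 1))

/-- `s = √((x₁ - y₁)² + (x₂ - y₂)² + (x₃ - y₃)²)`; here `s ≥ 0`, and the three differences are the
quantity variables `2, 1, 0`. -/
def isSpace (x y : Pt) (s : QTerm) : Fm :=
  .exQ (.exQ (.exQ
    (.var 2 ⊹ (y 1).up 3 ≐ (x 1).up 3 ⋏ .var 1 ⊹ (y 2).up 3 ≐ (x 2).up 3 ⋏
     .var 0 ⊹ (y 3).up 3 ≐ (x 3).up 3 ⋏ nonneg (s.up 3) ⋏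
     s.up 3 ⊡ s.up 3 ≐ .var 2 ⊡ .var 2 ⊹ .var 1 ⊡ .var 1 ⊹ .var 0 ⊡ .var 0)))

/-- `t = |x₀ - y₀|`. -/
def isTime (x y : Pt) (t : QTerm) : Fm :=
  nonneg t ⋏ (t ⊹ y 0 ≐ x 0 ⋎ t ⊹ x 0 ≐ y 0)

/-- `space(x, y) = c · time(x, y)`. -/
def spaceEq (x y : Pt) (c : QTerm) : Fm :=
  .exQ (.exQ (isSpace (x.up 2) (y.up 2) (.var 1) ⋏ isTime (x.up 2) (y.up 2) (.var 0) ⋏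
    .var 1 ≐ c.up 2 ⊡ .var 0))

/-- `space(x, y) < c · time(x, y)`. -/
def spaceLt (x y : Pt) (c : QTerm) : Fm :=
  .exQ (.exQ (isSpace (x.up 2) (y.up 2) (.var 1) ⋏ isTime (x.up 2) (y.up 2) (.var 0) ⋏
    lt (.var 1) (c.up 2 ⊡ .var 0)))

/-- `space(x, y) = space(x', y')`. -/
def sameSpace (x y x' y' : Pt) : Fm :=
  .exQ (isSpace (x.up 1) (y.up 1) (.var 0) ⋏ isSpace (x'.up 1) (y'.up 1) (.var 0))

/-- `time(x, y) = time(x', y')`. -/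
def sameTime (x y x' y' : Pt) : Fm :=
  .exQ (isTime (x.up 1) (y.up 1) (.var 0) ⋏ isTime (x'.up 1) (y'.up 1) (.var 0))

/-- `time(x, y) = 0`. -/
def zeroTime (x y : Pt) : Fm := .exQ (isTime (x.up 1) (y.up 1) (.var 0) ⋏ isZero (.var 0))

/-- `ev_k(x) = ev_h(y)`: the same bodies are coordinatized at `x` by `k` and at `y` by `h`. -/
def sameEv (k : ℕ) (x : Pt) (h : ℕ) (y : Pt) : Fm :=
  .allB (.wv (k + 1) 0 x ⇚⇛ .wv (h + 1) 0 y)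

/-- For `k`, light signals can be sent through `x` and `y` iff `space(x, y) = c · time(x, y)`. -/
def lightIff (k : ℕ) (c : QTerm) (x y : Pt) : Fm :=
  .exB (.ph 0 ⋏ .wv (k + 1) 0 x ⋏ .wv (k + 1) 0 y) ⇚⇛ spaceEq x y c

/-! ## The axioms

In the axioms `k = 0` and `h = 1` are body variables, and `x, y, z, w` are the points
with variables `0–3, 4–7, 8–11, 12–15`. -/

/-- `⟨Q, +, ·, ≤⟩` is a Euclidean field; `x, y, z` are the variables `0, 1, 2`, zero and one are the
variables `3` and `4`. -/
def AxEField : Fm :=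
  let x : QTerm := .var 0
  let y : QTerm := .var 1
  let z : QTerm := .var 2
  let o : QTerm := .var 3
  let i : QTerm := .var 4
  -- the field axioms
  allQs [0, 1, 2] ((x ⊹ y) ⊹ z ≐ x ⊹ (y ⊹ z)) ⋏
  allQs [0, 1] (x ⊹ y ≐ y ⊹ x) ⋏
  allQs [0, 1, 2] ((x ⊡ y) ⊡ z ≐ x ⊡ (y ⊡ z)) ⋏
  allQs [0, 1] (x ⊡ y ≐ y ⊡ x) ⋏
  allQs [0, 1, 2] (x ⊡ (y ⊹ z) ≐ x ⊡ y ⊹ x ⊡ z) ⋏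
  exQs [3, 4] (.neg (o ≐ i) ⋏ allQs [0] (x ⊹ o ≐ x) ⋏ allQs [0] (x ⊡ i ≐ x) ⋏
    allQs [0] (exQs [1] (x ⊹ y ≐ o)) ⋏
    allQs [0] (.neg (x ≐ o) ⇛ exQs [1] (x ⊡ y ≐ i))) ⋏
  -- linear order
  allQs [0] (.le x x) ⋏
  allQs [0, 1] (.le x y ⋏ .le y x ⇛ x ≐ y) ⋏
  allQs [0, 1, 2] (.le x y ⋏ .le y z ⇛ .le x z) ⋏
  allQs [0, 1] (.le x y ⋎ .le y x) ⋏
  -- compatibility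
  allQs [0, 1, 2] (.le x y ⇛ .le (x ⊹ z) (y ⊹ z)) ⋏
  allQs [0, 1] (nonneg x ⋏ nonneg y ⇛ nonneg (x ⊡ y)) ⋏
  -- square roots
  allQs [0] (pos x ⇛ exQs [1] (y ⊡ y ≐ x))

/-- All inertial observers coordinatize the same events. -/
def AxEv : Fm :=
  ∀ᴮ 0, ∀ᴮ 1, (.iob 0 ⋏ .iob 1 ⇛ allQs (ptVars 0) (exQs (ptVars 4) (sameEv 0 (pt 0) 1 (pt 4))))

/-- The world-line of an inertial observer is a straight line according to inertial observers.
With `a` the variable `16`, the matrix says `z - x = a (y - x)` or `y - z = a (z - x)`,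
subtractions being moved to the other side. -/
def AxLine : Fm :=
  let a : QTerm := .var 16
  let x := pt 0
  let y := pt 4
  let z := pt 8
  ∀ᴮ 0, ∀ᴮ 1, (.iob 0 ⋏ .iob 1 ⇛ allQs (ptVars 0 ++ ptVars 4 ++ ptVars 8)
    (.wv 0 1 x ⋏ .wv 0 1 y ⋏ .wv 0 1 z ⇛ ∃ᴽ 16,
      ((z 0 ⊹ a ⊡ x 0 ≐ x 0 ⊹ a ⊡ y 0 ⋏ z 1 ⊹ a ⊡ x 1 ≐ x 1 ⊹ a ⊡ y 1 ⋏
        z 2 ⊹ a ⊡ x 2 ≐ x 2 ⊹ a ⊡ y 2 ⋏ z 3 ⊹ a ⊡ x 3 ≐ x 3 ⊹ a ⊡ y 3) ⋎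
       (y 0 ⊹ a ⊡ x 0 ≐ z 0 ⊹ a ⊡ z 0 ⋏ y 1 ⊹ a ⊡ x 1 ≐ z 1 ⊹ a ⊡ z 1 ⋏
        y 2 ⊹ a ⊡ x 2 ≐ z 2 ⊹ a ⊡ z 2 ⋏ y 3 ⊹ a ⊡ x 3 ≐ z 3 ⊹ a ⊡ z 3))))

/-- Inertial observers are stationary in their own coordinate system. -/
def AxSelf : Fm :=
  ∀ᴮ 0, (.iob 0 ⇛ allQs (ptVars 0)
    (.wv 0 0 (pt 0) ⇚⇛ isZero (pt 0 1) ⋏ isZero (pt 0 2) ⋏ isZero (pt 0 3)))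

/-- Two inertial observers agree on the spatial distance of two events which are simultaneous for
both of them. -/
def AxSymD : Fm :=
  let x := pt 0
  let y := pt 4
  let x' := pt 8
  let y' := pt 12
  ∀ᴮ 0, ∀ᴮ 1, (.iob 0 ⋏ .iob 1 ⇛ allQs (ptVars 0 ++ ptVars 4 ++ ptVars 8 ++ ptVars 12)
    (zeroTime x y ⋏ zeroTime x' y' ⋏ sameEv 0 x 1 x' ⋏ sameEv 0 y 1 y' ⇛ sameSpace x y x' y'))

/-- The spatial matrix with entries the variables `8, …, 16`, applied to the spatial part of a
point. -/
def matApply (x : Pt) (i : Fin 3) : QTerm :=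
  .var (8 + 3 * i) ⊡ x 1 ⊹ .var (9 + 3 * i) ⊡ x 2 ⊹ .var (10 + 3 * i) ⊡ x 3

/-- Every trivial transformation of an inertial coordinate system gives an inertial coordinate
system. A trivial transformation is composed of an isometry `u ↦ A u + b` of space (the nine entries
of `A` are the variables `8, …, 16`, `b` is `17, 18, 19`) and a translation of time by the
variable `20`; `A u + b` is an isometry iff `A` preserves length. -/
def AxTriv : Fm :=
  let x := pt 0
  let y := pt 4
  allQs [8, 9, 10, 11, 12, 13, 14, 15, 16, 17, 18, 19, 20]
    (allQs (ptVars 0)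
      (matApply x 0 ⊡ matApply x 0 ⊹ matApply x 1 ⊡ matApply x 1 ⊹ matApply x 2 ⊡ matApply x 2 ≐
        x 1 ⊡ x 1 ⊹ x 2 ⊡ x 2 ⊹ x 3 ⊡ x 3) ⇛
     ∀ᴮ 0, (.iob 0 ⇛ ∃ᴮ 1, (.iob 1 ⋏ allQs (ptVars 0 ++ ptVars 4)
      (sameEv 0 x 1 y ⇚⇛
        y 0 ≐ x 0 ⊹ .var 20 ⋏ y 1 ≐ matApply x 0 ⊹ .var 17 ⋏
        y 2 ≐ matApply x 1 ⊹ .var 18 ⋏ y 3 ≐ matApply x 2 ⊹ .var 19))))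

/-- All observers (bodies coordinatizing some body somewhere) are inertial. -/
def AxNoAcc : Fm :=
  ∀ᴮ 0, (∃ᴮ 1, exQs (ptVars 0) (.wv 0 1 (pt 0))) ⇛ .iob 0

/-- The time difference of two events is the same for all inertial observers. -/
def AxAbsTime : Fm :=
  let x := pt 0
  let y := pt 4
  let x' := pt 8
  let y' := pt 12
  ∀ᴮ 0, ∀ᴮ 1, (.iob 0 ⋏ .iob 1 ⇛ allQs (ptVars 0 ++ ptVars 4 ++ ptVars 8 ++ ptVars 12)
    (sameEv 0 x 1 x' ⋏ sameEv 0 y 1 y' ⇛ sameTime x y x' y'))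

/-- Inertial observers can move along every non-horizontal straight line. -/
def AxThExpPlus : Fm :=
  let x := pt 0
  let y := pt 4
  (∃ᴮ 1, .iob 1) ⋏
  ∀ᴮ 0, (.iob 0 ⇛ allQs (ptVars 0 ++ ptVars 4)
    (.neg (x 0 ≐ y 0) ⇛ ∃ᴮ 1, (.iob 1 ⋏ .wv 0 1 x ⋏ .wv 0 1 y)))

/-- The body variable `e` is an ether observer; `c` is the variable `16`. -/
def ether (e : ℕ) : Fm :=
  .iob e ⋏ ∃ᴽ 16, (pos (.var 16) ⋏
    allQs (ptVars 0 ++ ptVars 4) (lightIff e (.var 16) (pt 0) (pt 4)))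

/-- There is an ether observer. -/
def AxEther : Fm := ∃ᴮ 0, ether 0

/-- The variable `16` is an observer-independent speed of light. -/
def isLightSpeed : Fm :=
  pos (.var 16) ⋏ ∀ᴮ 0, (.iob 0 ⇛
    allQs (ptVars 0 ++ ptVars 4) (lightIff 0 (.var 16) (pt 0) (pt 4)))

/-- The speed of light is the same for all inertial observers, everywhere, in every direction. -/
def AxPhc : Fm := ∃ᴽ 16, isLightSpeed

/-- Inertial observers can move along every straight line slower than light. -/
def AxThExp : Fm :=
  let x := pt 0
  let y := pt 4
  (∃ᴮ 1, .iob 1) ⋏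
  ∀ᴮ 0, (.iob 0 ⇛ allQs (ptVars 0 ++ ptVars 4)
    ((∃ᴽ 16, (isLightSpeed ⋏ spaceLt x y (.var 16))) ⇛
      ∃ᴮ 1, (.iob 1 ⋏ .wv 0 1 x ⋏ .wv 0 1 y)))

/-! ## The theories -/

def KinFull : Set Fm := {AxEField, AxEv, AxSelf, AxSymD, AxLine, AxTriv, AxNoAcc}

def ClassicalKinFull : Set Fm := KinFull ∪ {AxAbsTime, AxThExpPlus, AxEther}

def SpecRelFull : Set Fm := KinFull ∪ {AxPhc, AxThExp}

end Kinematics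

/-! The proof counts orbits of bodies under automorphisms. A translation keeps both sorts and
equality, so an interpretation defines, inside any model M of special relativity, a model N of
classical kinematics with the same bodies and the same quantities (`Translation.exists_model`). N is
definable without parameters, so every automorphism of M that fixes all quantities is an
automorphism of N (`Model.IsAut.sat_iff`, `Translation.isAut_model`).

In a classical model such automorphisms have at least three orbits. All ether observers are at rest
relative to one another: a sphere of light is centred at its emitter for each of them, and
simultaneous distances are absolute (`spaceSq_eq_of_lightSpeed`). Hence the speed of an inertial
body relative to the ether is a well-defined quantity (`HasSpeedSq.unique`), and it is preserved by
automorphisms, which fix quantities and permute ether observers (`HasSpeedSq.map`). Unbounded speeds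
are available, so there are bodies of speeds 0, 1 and 2, and no automorphism carries one of them to
another (`exists_inequivalent_bodies`).

Special relativity has a model with only two orbits. In `minkowski` over the reals there is one
observer and one photon for each element of the Poincaré group; left multiplication is an
automorphism fixing all quantities, and it is transitive on observers and on photons. So among any
three bodies two are equivalent (`minkowski.exists_isAut`), which contradicts the previous
paragraph. -/

namespace Kinematics

/-! ## Semantics -/

/-- A two-sorted structure for the language of kinematics. -/
structure Model (B Q : Type) where
  iob : B → Prop
  ph : B → Prop
  wv : B → B → (Fin 4 → Q) → Prop
  le : Q → Q → Prop
  add : Q → Q → Q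
  mul : Q → Q → Q

/-- The valuation giving `a` to the variable `0` and `f n` to the variable `n + 1`. -/
def scons {α : Type} (a : α) (f : ℕ → α) : ℕ → α
  | 0 => a
  | n + 1 => f n

@[simp] theorem scons_zero {α : Type} (a : α) (f : ℕ → α) : scons a f 0 = a := rfl

@[simp] theorem scons_succ {α : Type} (a : α) (f : ℕ → α) (n : ℕ) : scons a f (n + 1) = f n := rfl

namespace Model

variable {B Q : Type} (M : Model B Q)

/-- The value of a term. -/
def eval (σ : ℕ → Q) : QTerm → Q
  | .var n => σ n
  | .add s t => M.add (eval σ s) (eval σ t)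
  | .mul s t => M.mul (eval σ s) (eval σ t)

/-- Satisfaction of a formula under valuations of the body and the quantity variables. -/
def Sat : Fm → (ℕ → B) → (ℕ → Q) → Prop
  | .iob k, β, _ => M.iob (β k)
  | .ph p, β, _ => M.ph (β p)
  | .wv k b x, β, σ => M.wv (β k) (β b) (fun i => M.eval σ (x i))
  | .le s t, _, σ => M.le (M.eval σ s) (M.eval σ t)
  | .eqQ s t, _, σ => M.eval σ s = M.eval σ t
  | .eqB k b, β, _ => β k = β b
  | .neg φ, β, σ => ¬ Sat φ β σ
  | .imp φ ψ, β, σ => Sat φ β σ → Sat ψ β σ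
  | .allB φ, β, σ => ∀ b, Sat φ (scons b β) σ
  | .allQ φ, β, σ => ∀ q, Sat φ β (scons q σ)

variable {M}

@[simp] theorem eval_var (σ : ℕ → Q) (n : ℕ) : M.eval σ (.var n) = σ n := rfl
@[simp] theorem eval_add (σ : ℕ → Q) (s t : QTerm) :
    M.eval σ (.add s t) = M.add (M.eval σ s) (M.eval σ t) := rfl
@[simp] theorem eval_mul (σ : ℕ → Q) (s t : QTerm) :
    M.eval σ (.mul s t) = M.mul (M.eval σ s) (M.eval σ t) := rfl

section
variable (β : ℕ → B) (σ : ℕ → Q)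

@[simp] theorem sat_iob (k : ℕ) : M.Sat (.iob k) β σ ↔ M.iob (β k) := Iff.rfl
@[simp] theorem sat_ph (k : ℕ) : M.Sat (.ph k) β σ ↔ M.ph (β k) := Iff.rfl
@[simp] theorem sat_wv (k b : ℕ) (x : Fin 4 → QTerm) :
    M.Sat (.wv k b x) β σ ↔ M.wv (β k) (β b) (fun i => M.eval σ (x i)) := Iff.rfl
@[simp] theorem sat_le (s t : QTerm) :
    M.Sat (.le s t) β σ ↔ M.le (M.eval σ s) (M.eval σ t) := Iff.rfl
@[simp] theorem sat_eqQ (s t : QTerm) : M.Sat (.eqQ s t) β σ ↔ M.eval σ s = M.eval σ t := Iff.rfl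
@[simp] theorem sat_eqB (k b : ℕ) : M.Sat (.eqB k b) β σ ↔ β k = β b := Iff.rfl
@[simp] theorem sat_neg (φ : Fm) : M.Sat (.neg φ) β σ ↔ ¬ M.Sat φ β σ := Iff.rfl
@[simp] theorem sat_imp (φ ψ : Fm) :
    M.Sat (.imp φ ψ) β σ ↔ (M.Sat φ β σ → M.Sat ψ β σ) := Iff.rfl
@[simp] theorem sat_allB (φ : Fm) : M.Sat (.allB φ) β σ ↔ ∀ b, M.Sat φ (scons b β) σ := Iff.rfl
@[simp] theorem sat_allQ (φ : Fm) : M.Sat (.allQ φ) β σ ↔ ∀ q, M.Sat φ β (scons q σ) := Iff.rfl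
@[simp] theorem sat_and (φ ψ : Fm) : M.Sat (φ.and ψ) β σ ↔ M.Sat φ β σ ∧ M.Sat ψ β σ := by
  simp [Fm.and]
@[simp] theorem sat_or (φ ψ : Fm) : M.Sat (φ.or ψ) β σ ↔ M.Sat φ β σ ∨ M.Sat ψ β σ := by
  simp [Fm.or, or_iff_not_imp_left]
@[simp] theorem sat_iff (φ ψ : Fm) : M.Sat (φ.iff ψ) β σ ↔ (M.Sat φ β σ ↔ M.Sat ψ β σ) := by
  simp [Fm.iff, iff_iff_implies_and_implies]
@[simp] theorem sat_exB (φ : Fm) : M.Sat φ.exB β σ ↔ ∃ b, M.Sat φ (scons b β) σ := by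
  simp [Fm.exB]
@[simp] theorem sat_exQ (φ : Fm) : M.Sat φ.exQ β σ ↔ ∃ q, M.Sat φ β (scons q σ) := by
  simp [Fm.exQ]

end

/-! ### Substitution -/

theorem eval_subst (τ : ℕ → QTerm) (σ : ℕ → Q) (t : QTerm) :
    M.eval σ (t.subst τ) = M.eval (fun n => M.eval σ (τ n)) t := by
  induction t with
  | var n => rfl
  | add s t hs ht => simp [QTerm.subst, hs, ht]
  | mul s t hs ht => simp [QTerm.subst, hs, ht]

theorem eval_up (σ : ℕ → Q) (d : ℕ) (t : QTerm) :
    M.eval σ (t.up d) = M.eval (fun n => σ (n + d)) t := by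
  simp [QTerm.up, eval_subst]

theorem scons_comp_liftB (b : B) (β : ℕ → B) (f : ℕ → ℕ) :
    (fun n => scons b β (liftB f n)) = scons b (fun n => β (f n)) := by
  funext n; cases n <;> rfl

theorem eval_liftQ (q : Q) (σ : ℕ → Q) (τ : ℕ → QTerm) :
    (fun n => M.eval (scons q σ) (liftQ τ n)) = scons q (fun n => M.eval σ (τ n)) := by
  funext n
  cases n with
  | zero => rfl
  | succ n => simp [liftQ, eval_up]

theorem sat_subst (φ : Fm) (f : ℕ → ℕ) (τ : ℕ → QTerm) (β : ℕ → B) (σ : ℕ → Q) :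
    M.Sat (φ.subst f τ) β σ ↔ M.Sat φ (fun n => β (f n)) (fun n => M.eval σ (τ n)) := by
  induction φ generalizing f τ β σ with
  | iob k => rfl
  | ph p => rfl
  | eqB k b => rfl
  | wv k b x => simp [Fm.subst, eval_subst]
  | le s t => simp [Fm.subst, eval_subst]
  | eqQ s t => simp [Fm.subst, eval_subst]
  | neg φ h => simp [Fm.subst, h]
  | imp φ ψ h₁ h₂ => simp [Fm.subst, h₁, h₂]
  | allB φ h => simp [Fm.subst, h, scons_comp_liftB]
  | allQ φ h => simp [Fm.subst, h, eval_liftQ]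

theorem sat_instB (φ : Fm) (b : ℕ) (β : ℕ → B) (σ : ℕ → Q) :
    M.Sat (φ.instB b) β σ ↔ M.Sat φ (scons (β b) β) σ := by
  rw [Fm.instB, sat_subst]
  have : (fun n => β (match n with | 0 => b | m + 1 => m)) = scons (β b) β := by
    funext n; cases n <;> rfl
  exact iff_of_eq (congrArg (fun f => M.Sat φ f σ) this)

theorem sat_instQ (φ : Fm) (t : QTerm) (β : ℕ → B) (σ : ℕ → Q) :
    M.Sat (φ.instQ t) β σ ↔ M.Sat φ β (scons (M.eval σ t) σ) := by
  rw [Fm.instQ, sat_subst]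
  have : (fun n => M.eval σ (match n with | 0 => t | m + 1 => .var m)) =
      scons (M.eval σ t) σ := by
    funext n; cases n <;> rfl
  exact iff_of_eq (congrArg (fun f => M.Sat φ β f) this)

/-- Every theorem of a theory is true in every model of the theory. -/
theorem sat_of_proves {T : Set Fm} (hT : ∀ φ ∈ T, ∀ β σ, M.Sat φ β σ) {φ : Fm} (h : Proves T φ) :
    ∀ β σ, M.Sat φ β σ := by
  induction h with
  | ax h => exact hT _ h
  | taut h => exact fun β σ => h (fun ψ => M.Sat ψ β σ) (fun _ => Iff.rfl) (fun _ _ => Iff.rfl)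
  | allB_imp φ ψ =>
    intro β σ h hφ b
    exact h b ((sat_subst φ _ _ _ _).2 hφ)
  | allQ_imp φ ψ =>
    intro β σ h hφ q
    exact h q ((sat_subst φ _ _ _ _).2 hφ)
  | allB_inst φ b => exact fun β σ h => (sat_instB φ b β σ).2 (h _)
  | allQ_inst φ t => exact fun β σ h => (sat_instQ φ t β σ).2 (h _)
  | eqB_refl b => exact fun β σ => rfl
  | eqQ_refl t => exact fun β σ => rfl
  | eqB_subst φ b b' =>
    intro β σ h
    rw [sat_eqB] at h
    simp [sat_instB, h]
  | eqQ_subst φ t t' =>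
    intro β σ h
    rw [sat_eqQ] at h
    simp [sat_instQ, h]
  | mp _ _ h₁ h₂ => exact fun β σ => h₁ β σ (h₂ β σ)
  | genB _ h => exact fun β σ b => h _ _
  | genQ _ h => exact fun β σ q => h _ _

/-! ### Coincidence -/

theorem eval_congr {n : ℕ} {t : QTerm} (ht : t.VarsBelow n) {σ σ' : ℕ → Q}
    (h : ∀ i < n, σ i = σ' i) : M.eval σ t = M.eval σ' t := by
  induction t with
  | var i => exact h i ht
  | add s t hs h't => simp [hs ht.1, h't ht.2]
  | mul s t hs h't => simp [hs ht.1, h't ht.2]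

theorem scons_congr {α : Type} {n : ℕ} (a : α) {f f' : ℕ → α} (h : ∀ i < n, f i = f' i) :
    ∀ i < n + 1, scons a f i = scons a f' i := by
  intro i hi
  cases i with
  | zero => rfl
  | succ i => exact h i (by omega)

/-- This lets the formulas of a translation be evaluated with arbitrary values at all variables
beyond their arguments, so that they define relations on the structure without parameters. -/
theorem sat_congr {φ : Fm} {m n : ℕ} (hφ : φ.FreeBelow m n) {β β' : ℕ → B} {σ σ' : ℕ → Q}
    (hβ : ∀ i < m, β i = β' i) (hσ : ∀ i < n, σ i = σ' i) : M.Sat φ β σ ↔ M.Sat φ β' σ' := by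
  induction φ generalizing m n β β' σ σ' with
  | iob k => simp [hβ k hφ]
  | ph k => simp [hβ k hφ]
  | wv k b x => simp [hβ k hφ.1, hβ b hφ.2.1, fun i => eval_congr (M := M) (hφ.2.2 i) hσ]
  | le s t => simp [eval_congr (M := M) hφ.1 hσ, eval_congr (M := M) hφ.2 hσ]
  | eqQ s t => simp [eval_congr (M := M) hφ.1 hσ, eval_congr (M := M) hφ.2 hσ]
  | eqB k b => simp [hβ k hφ.1, hβ b hφ.2]
  | neg φ h => exact not_congr (h hφ hβ hσ)
  | imp φ ψ h₁ h₂ => exact imp_congr (h₁ hφ.1 hβ hσ) (h₂ hφ.2 hβ hσ)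
  | allB φ h => exact forall_congr' fun b => h hφ (scons_congr b hβ) hσ
  | allQ φ h => exact forall_congr' fun q => h hφ hβ (scons_congr q hσ)

/-! ### Automorphisms -/

variable (M) in
/-- Automorphisms that fix all quantities. -/
structure IsAut (g : B ≃ B) : Prop where
  iob : ∀ k, M.iob (g k) ↔ M.iob k
  ph : ∀ p, M.ph (g p) ↔ M.ph p
  wv : ∀ k b x, M.wv (g k) (g b) x ↔ M.wv k b x

/-- Truth is invariant under automorphisms, hence so is everything definable without body
parameters. The quantifier over bodies is where surjectivity of `g` enters. -/
theorem IsAut.sat_iff {g : B ≃ B} (hg : M.IsAut g) (φ : Fm) (β : ℕ → B) (σ : ℕ → Q) :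
    M.Sat φ (fun n => g (β n)) σ ↔ M.Sat φ β σ := by
  induction φ generalizing β σ with
  | iob k => exact hg.iob _
  | ph k => exact hg.ph _
  | wv k b x => exact hg.wv _ _ _
  | le s t => rfl
  | eqQ s t => rfl
  | eqB k b => exact g.apply_eq_iff_eq
  | neg φ h => exact not_congr (h _ _)
  | imp φ ψ h₁ h₂ => exact imp_congr (h₁ _ _) (h₂ _ _)
  | allQ φ h => exact forall_congr' fun q => h _ _
  | allB φ h =>
    have key (b : B) : (fun n => g (scons b β n)) = scons (g b) (fun n => g (β n)) := by
      funext n; cases n <;> rfl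
    simp only [sat_allB]
    rw [← g.forall_congr_right]
    exact forall_congr' fun b => by rw [← key, h]

end Model

/-! ## Models and translations -/

namespace Translation

variable {B Q : Type} (T : Translation) (M : Model B Q)

/-- The valuation listing `a` and the members of `l`, with the value `a` for all further variables. -/
def listVal {α : Type} (a : α) (l : List α) (n : ℕ) : α := (a :: l).getD n a

/-- The translated graph of addition. -/
def AddRel (b₀ : B) (x y z : Q) : Prop := M.Sat T.add (fun _ => b₀) (listVal x [y, z])

/-- The translated graph of multiplication. -/
def MulRel (b₀ : B) (x y z : Q) : Prop := M.Sat T.mul (fun _ => b₀) (listVal x [y, z])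

/-- The structure defined in `M` by a translation, where `add` and `mul` are to be the functions with
the translated graphs. -/
def model (b₀ : B) (q₀ : Q) (add mul : Q → Q → Q) : Model B Q where
  iob k := M.Sat T.iob (fun _ => k) (fun _ => q₀)
  ph p := M.Sat T.ph (fun _ => p) (fun _ => q₀)
  wv k b x := M.Sat T.wv (listVal k [b]) (listVal (x 0) [x 1, x 2, x 3])
  le x y := M.Sat T.le (fun _ => b₀) (listVal x [y])
  add := add
  mul := mul

variable {T M} {b₀ : B} {q₀ : Q} {add mul : Q → Q → Q}

theorem sat_add_subst (x y z : ℕ) (β : ℕ → B) (σ : ℕ → Q) :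
    M.Sat (T.add.subst id (vars [x, y, z])) β σ ↔ T.AddRel M b₀ (σ x) (σ y) (σ z) := by
  rw [Model.sat_subst]
  refine Model.sat_congr T.add_free (by simp) ?_
  intro i hi
  interval_cases i <;> rfl

theorem sat_mul_subst (x y z : ℕ) (β : ℕ → B) (σ : ℕ → Q) :
    M.Sat (T.mul.subst id (vars [x, y, z])) β σ ↔ T.MulRel M b₀ (σ x) (σ y) (σ z) := by
  rw [Model.sat_subst]
  refine Model.sat_congr T.mul_free (by simp) ?_
  intro i hi
  interval_cases i <;> rfl

theorem sat_placeVal (γ : Fm) (j d : ℕ) (β : ℕ → B) (σ : ℕ → Q) :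
    M.Sat (placeVal γ j d) β σ ↔ M.Sat γ β (scons (σ j) (fun m => σ (m + d))) := by
  rw [placeVal, Model.sat_subst]
  have : (fun n => M.eval σ (match n with | 0 => QTerm.var j | m + 1 => .var (m + d))) =
      scons (σ j) (fun m => σ (m + d)) := by
    funext n; cases n <;> rfl
  exact iff_of_eq (congrArg (fun f => M.Sat γ β f) this)

/-- Once the translated relations are graphs of functions, the intermediate values in the unnested
term are forced to be the values of the subterms. -/
theorem sat_graph (hadd : ∀ x y z, T.AddRel M b₀ x y z ↔ add x y = z)
    (hmul : ∀ x y z, T.MulRel M b₀ x y z ↔ mul x y = z) (t : QTerm) (β : ℕ → B) (σ : ℕ → Q) (q : Q) :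
    M.Sat (T.graph t) β (scons q σ) ↔ (T.model M b₀ q₀ add mul).eval σ t = q := by
  induction t generalizing q σ with
  | var m => simp [graph]
  | add s t hs ht =>
    simp [graph, sat_placeVal, hs, ht, sat_add_subst (b₀ := b₀), hadd]
    rfl
  | mul s t hs ht =>
    simp [graph, sat_placeVal, hs, ht, sat_mul_subst (b₀ := b₀), hmul]
    rfl

/-- A formula is true in the structure defined by a translation iff its translation is true. -/
theorem sat_tr (hadd : ∀ x y z, T.AddRel M b₀ x y z ↔ add x y = z)
    (hmul : ∀ x y z, T.MulRel M b₀ x y z ↔ mul x y = z) (φ : Fm) (β : ℕ → B) (σ : ℕ → Q) :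
    M.Sat (T.tr φ) β σ ↔ (T.model M b₀ q₀ add mul).Sat φ β σ := by
  have hg := sat_graph (q₀ := q₀) hadd hmul
  induction φ generalizing β σ with
  | iob k =>
    rw [tr, Model.sat_subst]
    exact Model.sat_congr T.iob_free (by simp) (by simp)
  | ph k =>
    rw [tr, Model.sat_subst]
    exact Model.sat_congr T.ph_free (by simp) (by simp)
  | wv k b x =>
    have key (β : ℕ → B) (σ : ℕ → Q) : M.Sat (T.wv.subst (fun n => [k, b].getD n 0) (vars [3, 2, 1, 0])) β σ ↔
        (T.model M b₀ q₀ add mul).wv (β k) (β b) ![σ 3, σ 2, σ 1, σ 0] := by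
      rw [Model.sat_subst]
      refine Model.sat_congr T.wv_free ?_ ?_ <;> intro i hi <;> interval_cases i <;> rfl
    have hx : (fun i => (T.model M b₀ q₀ add mul).eval σ (x i)) =
        ![(T.model M b₀ q₀ add mul).eval σ (x 0), (T.model M b₀ q₀ add mul).eval σ (x 1),
          (T.model M b₀ q₀ add mul).eval σ (x 2), (T.model M b₀ q₀ add mul).eval σ (x 3)] := by
      funext i; fin_cases i <;> rfl
    simp [tr, sat_placeVal, hg, key, hx, -List.getD_eq_getElem?_getD]
  | le s t =>
    have key (β : ℕ → B) (σ : ℕ → Q) : M.Sat (T.le.subst id (vars [1, 0])) β σ ↔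
        (T.model M b₀ q₀ add mul).le (σ 1) (σ 0) := by
      rw [Model.sat_subst]
      refine Model.sat_congr T.le_free (by simp) ?_
      intro i hi
      interval_cases i <;> rfl
    simp [tr, sat_placeVal, hg, key]
  | eqQ s t =>
    -- `tr` treats an equation between two variables separately from the other equations.
    cases s <;> cases t <;> simp [tr, hg, eq_comm]
  | eqB k b => rfl
  | neg φ h => exact not_congr (h _ _)
  | imp φ ψ h₁ h₂ => exact imp_congr (h₁ _ _) (h₂ _ _)
  | allB φ h => exact forall_congr' fun b => h _ _
  | allQ φ h => exact forall_congr' fun q => h _ _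

theorem isAut_model {g : B ≃ B} (hg : M.IsAut g) : (T.model M b₀ q₀ add mul).IsAut g where
  iob k := hg.sat_iff T.iob (fun _ => k) _
  ph k := hg.sat_iff T.ph (fun _ => k) _
  wv k b x := by
    refine Iff.trans (Model.sat_congr T.wv_free ?_ (fun _ _ => rfl))
      (hg.sat_iff T.wv (listVal k [b]) _)
    intro i hi
    interval_cases i <;> rfl

/-- An interpretation of `Th₁` in `Th₂` defines in every model of `Th₂` a model of `Th₁`, which
inherits the automorphisms. -/
theorem exists_model {Th₁ Th₂ : Set Fm} (hT : IsInterpretation T Th₁ Th₂)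
    (hM : ∀ φ ∈ Th₂, ∀ β σ, M.Sat φ β σ) [Nonempty B] [Nonempty Q] :
    ∃ N : Model B Q, (∀ φ ∈ Th₁, ∀ β σ, N.Sat φ β σ) ∧ ∀ g, M.IsAut g → N.IsAut g := by
  obtain ⟨b₀⟩ := ‹Nonempty B›
  obtain ⟨q₀⟩ := ‹Nonempty Q›
  have key (φ : Fm) (h : Proves Th₁ φ) (β σ) : M.Sat (T.tr φ) β σ :=
    Model.sat_of_proves hM (hT φ h) β σ
  -- Functionality of the translated relation is forced by logic alone. Totality: the translation of
  -- the provable equation `v₀ + v₁ = v₀ + v₁` asserts that a value exists.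
  have hadd (x y : Q) : ∃ z, ∀ z', T.AddRel M b₀ x y z' ↔ z = z' := by
    have h₁ := key _ (.eqQ_refl (.var 0 ⊹ .var 1)) (fun _ => b₀) (listVal x [y])
    simp [tr, graph, sat_placeVal, sat_add_subst (b₀ := b₀)] at h₁
    obtain ⟨z, hz⟩ := h₁
    refine ⟨z, fun z' => ⟨fun hz' => ?_, fun h => h ▸ hz⟩⟩
    -- Uniqueness. Instantiation lowers the variable 4 to 3, so the theorem reads `v₀ + v₁ = v₂ → v₀
    -- + v₁ = v₃ → v₂ = v₃`; its conclusion is an equation between variables, which the translation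
    -- leaves unchanged.
    have h₂ := key _ (.eqQ_subst (.var 0 ≐ .var 4) (.var 0 ⊹ .var 1) (.var 2)) (fun _ => b₀)
      (listVal x [y, z, z'])
    simp [tr, graph, sat_placeVal, sat_add_subst (b₀ := b₀), Fm.instQ, Fm.subst, QTerm.subst] at h₂
    exact h₂ hz hz'
  have hmul (x y : Q) : ∃ z, ∀ z', T.MulRel M b₀ x y z' ↔ z = z' := by
    have h₁ := key _ (.eqQ_refl (.var 0 ⊡ .var 1)) (fun _ => b₀) (listVal x [y])
    simp [tr, graph, sat_placeVal, sat_mul_subst (b₀ := b₀)] at h₁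
    obtain ⟨z, hz⟩ := h₁
    refine ⟨z, fun z' => ⟨fun hz' => ?_, fun h => h ▸ hz⟩⟩
    have h₂ := key _ (.eqQ_subst (.var 0 ≐ .var 4) (.var 0 ⊡ .var 1) (.var 2)) (fun _ => b₀)
      (listVal x [y, z, z'])
    simp [tr, graph, sat_placeVal, sat_mul_subst (b₀ := b₀), Fm.instQ, Fm.subst, QTerm.subst] at h₂
    exact h₂ hz hz'
  choose add hadd using hadd
  choose mul hmul using hmul
  exact ⟨T.model M b₀ q₀ add mul,
    fun φ hφ β σ => (sat_tr hadd hmul φ β σ).1 (key φ (.ax hφ) β σ), fun g hg => isAut_model hg⟩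

end Translation

end Kinematics
namespace Kinematics

/-! ## The meaning of the axioms -/

/-- The valuation `σ` with the variables `n, …, n + 3` changed to the coordinates of `x`. -/
def updPt {Q : Type} (σ : ℕ → Q) (n : ℕ) (x : Fin 4 → Q) : ℕ → Q :=
  Function.update (Function.update (Function.update (Function.update σ n (x 0)) (n + 1) (x 1))
    (n + 2) (x 2)) (n + 3) (x 3)

/-- The point with coordinates the values of the variables `n, …, n + 3`. -/
def ptVal {Q : Type} (σ : ℕ → Q) (n : ℕ) : Fin 4 → Q := fun i => σ (n + i)

@[simp] theorem ptVal_updPt_self {Q : Type} (σ : ℕ → Q) (n : ℕ) (x : Fin 4 → Q) :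
    ptVal (updPt σ n x) n = x := by
  funext i
  fin_cases i <;> simp [ptVal, updPt]

theorem updPt_of_ne {Q : Type} (σ : ℕ → Q) {n m : ℕ} (x : Fin 4 → Q) (h : m < n ∨ n + 4 ≤ m) :
    updPt σ n x m = σ m := by
  have h₀ : m ≠ n := by omega
  have h₁ : m ≠ n + 1 := by omega
  have h₂ : m ≠ n + 2 := by omega
  have h₃ : m ≠ n + 3 := by omega
  simp [updPt, h₀, h₁, h₂, h₃]

theorem ptVal_updPt_of_ne {Q : Type} (σ : ℕ → Q) {n m : ℕ} (x : Fin 4 → Q)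
    (h : m + 4 ≤ n ∨ n + 4 ≤ m) : ptVal (updPt σ n x) m = ptVal σ m := by
  funext i
  exact updPt_of_ne σ x (by omega)

theorem ptVal_update_of_ne {Q : Type} (σ : ℕ → Q) {n m : ℕ} (q : Q) (h : m < n ∨ n + 4 ≤ m) :
    ptVal (Function.update σ m q) n = ptVal σ n := by
  funext i
  have : n + (i : ℕ) ≠ m := by omega
  simp [ptVal, this]

/-- The square of the spatial distance. -/
def spaceSq {Q : Type} [Ring Q] (x y : Fin 4 → Q) : Q :=
  (x 1 - y 1) ^ 2 + (x 2 - y 2) ^ 2 + (x 3 - y 3) ^ 2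

namespace Model

variable {B Q : Type} {N : Model B Q}

@[simp] theorem eval_pt (σ : ℕ → Q) (n : ℕ) (i : Fin 4) : N.eval σ (pt n i) = ptVal σ n i := rfl

theorem eval_ptUp (σ : ℕ → Q) (x : Pt) (d : ℕ) (i : Fin 4) :
    N.eval σ (x.up d i) = N.eval (fun n => σ (n + d)) (x i) := eval_up σ d (x i)

@[simp] theorem sat_bindB (v : ℕ) (φ : Fm) (b : B) (β : ℕ → B) (σ : ℕ → Q) :
    N.Sat (φ.bindB v) (scons b β) σ ↔ N.Sat φ (Function.update β v b) σ := by
  rw [Fm.bindB, sat_subst]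
  have : (fun n => scons b β (if n = v then 0 else n + 1)) = Function.update β v b := by
    funext n; by_cases h : n = v <;> simp [h]
  rw [this]; rfl

@[simp] theorem sat_bindQ (v : ℕ) (φ : Fm) (q : Q) (β : ℕ → B) (σ : ℕ → Q) :
    N.Sat (φ.bindQ v) β (scons q σ) ↔ N.Sat φ β (Function.update σ v q) := by
  rw [Fm.bindQ, sat_subst]
  have : (fun n => N.eval (scons q σ) (if n = v then .var 0 else .var (n + 1))) =
      Function.update σ v q := by
    funext n; by_cases h : n = v <;> simp [h]
  rw [this]; rfl

@[simp] theorem sat_allQs_nil (φ : Fm) (β : ℕ → B) (σ : ℕ → Q) :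
    N.Sat (allQs [] φ) β σ ↔ N.Sat φ β σ := Iff.rfl

theorem sat_allQs_cons (v : ℕ) (l : List ℕ) (φ : Fm) (β : ℕ → B) (σ : ℕ → Q) :
    N.Sat (allQs (v :: l) φ) β σ ↔ ∀ q, N.Sat (allQs l φ) β (Function.update σ v q) := by
  simp only [allQs, List.foldr_cons, sat_allQ, sat_bindQ]

@[simp] theorem sat_exQs_nil (φ : Fm) (β : ℕ → B) (σ : ℕ → Q) :
    N.Sat (exQs [] φ) β σ ↔ N.Sat φ β σ := Iff.rfl

theorem sat_exQs_cons (v : ℕ) (l : List ℕ) (φ : Fm) (β : ℕ → B) (σ : ℕ → Q) :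
    N.Sat (exQs (v :: l) φ) β σ ↔ ∃ q, N.Sat (exQs l φ) β (Function.update σ v q) := by
  simp only [exQs, List.foldr_cons, sat_exQ, sat_bindQ]

@[simp] theorem sat_allQs_ptVars_append (n : ℕ) (l : List ℕ) (φ : Fm) (β : ℕ → B) (σ : ℕ → Q) :
    N.Sat (allQs (ptVars n ++ l) φ) β σ ↔ ∀ x, N.Sat (allQs l φ) β (updPt σ n x) := by
  simp only [ptVars, List.cons_append, List.nil_append, sat_allQs_cons]
  exact ⟨fun h x => h _ _ _ _, fun h a b c d => h ![a, b, c, d]⟩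

@[simp] theorem sat_allQs_ptVars (n : ℕ) (φ : Fm) (β : ℕ → B) (σ : ℕ → Q) :
    N.Sat (allQs (ptVars n) φ) β σ ↔ ∀ x, N.Sat φ β (updPt σ n x) :=
  sat_allQs_ptVars_append n [] φ β σ

@[simp] theorem sat_exQs_ptVars (n : ℕ) (φ : Fm) (β : ℕ → B) (σ : ℕ → Q) :
    N.Sat (exQs (ptVars n) φ) β σ ↔ ∃ x, N.Sat φ β (updPt σ n x) := by
  simp only [ptVars, sat_exQs_cons, sat_exQs_nil]
  exact ⟨fun ⟨a, b, c, d, h⟩ => ⟨![a, b, c, d], h⟩, fun ⟨x, h⟩ => ⟨_, _, _, _, h⟩⟩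

variable (N) in
/-- `ev_k(x) = ev_h(y)`. -/
def SameEv (k : B) (x : Fin 4 → Q) (h : B) (y : Fin 4 → Q) : Prop := ∀ b, N.wv k b x ↔ N.wv h b y

@[simp] theorem sat_sameEv (k h : ℕ) (x y : Pt) (β : ℕ → B) (σ : ℕ → Q) :
    N.Sat (sameEv k x h y) β σ ↔
      N.SameEv (β k) (fun i => N.eval σ (x i)) (β h) (fun i => N.eval σ (y i)) := by
  simp [sameEv, SameEv]

variable (N) in
/-- For the observer `k`, light moves with speed `c`. -/
def LightSpeed [Ring Q] (k : B) (c : Q) : Prop :=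
  ∀ x y, (∃ p, N.ph p ∧ N.wv k p x ∧ N.wv k p y) ↔ spaceSq x y = (c * (x 0 - y 0)) ^ 2

theorem sat_axEv (β : ℕ → B) (σ : ℕ → Q) :
    N.Sat AxEv β σ ↔ ∀ k h, N.iob k → N.iob h → ∀ x, ∃ y, N.SameEv k x h y := by
  simp [AxEv, ptVal_updPt_of_ne]

theorem sat_axNoAcc (β : ℕ → B) (σ : ℕ → Q) : N.Sat AxNoAcc β σ ↔ ∀ k b x, N.wv k b x → N.iob k := by
  simp [AxNoAcc]

theorem sat_axThExpPlus (β : ℕ → B) (σ : ℕ → Q) : N.Sat AxThExpPlus β σ ↔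
    (∃ k, N.iob k) ∧ ∀ k, N.iob k → ∀ x y : Fin 4 → Q, x 0 ≠ y 0 →
      ∃ k', N.iob k' ∧ N.wv k k' x ∧ N.wv k k' y := by
  simp [AxThExpPlus, ptVal_updPt_of_ne]

variable (N) in
/-- The operations and the order of the structure are those of the ordered field `Q`. -/
structure Standard [Field Q] [LinearOrder Q] : Prop where
  add : ∀ a b, N.add a b = a + b
  mul : ∀ a b, N.mul a b = a * b
  le : ∀ a b, N.le a b ↔ a ≤ b

/-! ### Defined notions and axioms over an ordered field -/

namespace Standard

section Notions

variable [Field Q] [LinearOrder Q] (hN : N.Standard) (β : ℕ → B) (σ : ℕ → Q)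
include hN

theorem sat_isZero (t : QTerm) : N.Sat (isZero t) β σ ↔ N.eval σ t = 0 := by
  simp [isZero, eval_up, hN.add]

theorem sat_lt (s t : QTerm) : N.Sat (lt s t) β σ ↔ N.eval σ s < N.eval σ t := by
  simp [lt, hN.le, lt_iff_le_and_ne]

theorem sat_nonneg (t : QTerm) : N.Sat (nonneg t) β σ ↔ 0 ≤ N.eval σ t := by
  simp [nonneg, eval_up, hN.le, hN.sat_isZero]

theorem sat_pos (t : QTerm) : N.Sat (pos t) β σ ↔ 0 < N.eval σ t := by
  simp [pos, eval_up, hN.sat_lt, hN.sat_isZero]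

theorem sat_isSpace (x y : Pt) (s : QTerm) : N.Sat (isSpace x y s) β σ ↔
    0 ≤ N.eval σ s ∧
      N.eval σ s ^ 2 = spaceSq (fun i => N.eval σ (x i)) (fun i => N.eval σ (y i)) := by
  simp [isSpace, eval_up, hN.sat_nonneg, hN.add, hN.mul, ← eq_sub_iff_add_eq, spaceSq, sq]

theorem sat_isTime [IsStrictOrderedRing Q] (x y : Pt) (t : QTerm) : N.Sat (isTime x y t) β σ ↔
    N.eval σ t = |N.eval σ (x 0) - N.eval σ (y 0)| := by
  simp only [isTime, sat_and, hN.sat_nonneg, sat_or, sat_eqQ, eval_add, hN.add]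
  constructor
  · rintro ⟨h, h' | h'⟩
    · rw [← h', add_sub_cancel_right, abs_of_nonneg h]
    · rw [← h', ← sub_sub, sub_sub_cancel_left, abs_neg, abs_of_nonneg h]
  · intro h
    rw [h]
    refine ⟨abs_nonneg _, ?_⟩
    rcases abs_choice (N.eval σ (x 0) - N.eval σ (y 0)) with h | h <;> rw [h] <;> simp

/-- For `c ≥ 0` both sides of the equation are nonnegative, so it may be squared; this removes the
root and the absolute value. -/
theorem sat_spaceEq [IsStrictOrderedRing Q] (x y : Pt) (c : QTerm) (hc : 0 ≤ N.eval σ c) :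
    N.Sat (spaceEq x y c) β σ ↔
      spaceSq (fun i => N.eval σ (x i)) (fun i => N.eval σ (y i)) =
        (N.eval σ c * (N.eval σ (x 0) - N.eval σ (y 0))) ^ 2 := by
  simp only [spaceEq, sat_exQ, sat_and, hN.sat_isSpace, hN.sat_isTime, sat_eqQ, eval_ptUp, eval_up,
    eval_var, eval_mul, hN.mul, scons_zero, scons_succ]
  constructor
  · rintro ⟨s, t, ⟨-, h⟩, rfl, rfl⟩
    rw [← h, mul_pow, mul_pow, sq_abs]
  · intro h
    exact ⟨_, _, ⟨mul_nonneg hc (abs_nonneg _), by rw [h, mul_pow, mul_pow, sq_abs]⟩, rfl, rfl⟩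

/-- One direction suffices, because the inequality only occurs in the premise of `AxThExp`. The
converse would also need the distance to exist in `Q`. -/
theorem sat_spaceLt [IsStrictOrderedRing Q] (x y : Pt) (c : QTerm)
    (h : N.Sat (spaceLt x y c) β σ) :
    spaceSq (fun i => N.eval σ (x i)) (fun i => N.eval σ (y i)) <
      (N.eval σ c * (N.eval σ (x 0) - N.eval σ (y 0))) ^ 2 := by
  simp only [spaceLt, sat_exQ, sat_and, hN.sat_isSpace, hN.sat_isTime, hN.sat_lt, eval_ptUp, eval_up,
    eval_var, eval_mul, hN.mul, scons_zero, scons_succ] at h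
  obtain ⟨s, t, ⟨h₀, h⟩, rfl, h'⟩ := h
  rw [← h, mul_pow, ← sq_abs (_ - _), ← mul_pow]
  exact pow_lt_pow_left₀ h' h₀ two_ne_zero

theorem sat_sameSpace (x y x' y' : Pt) : N.Sat (sameSpace x y x' y') β σ ↔
    ∃ s, 0 ≤ s ∧ s ^ 2 = spaceSq (fun i => N.eval σ (x i)) (fun i => N.eval σ (y i)) ∧
      s ^ 2 = spaceSq (fun i => N.eval σ (x' i)) (fun i => N.eval σ (y' i)) := by
  simp only [sameSpace, sat_exQ, sat_and, hN.sat_isSpace, eval_ptUp, eval_var, scons_zero,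
    scons_succ]
  exact exists_congr fun s => by tauto

theorem sat_sameTime [IsStrictOrderedRing Q] (x y x' y' : Pt) : N.Sat (sameTime x y x' y') β σ ↔
    |N.eval σ (x 0) - N.eval σ (y 0)| = |N.eval σ (x' 0) - N.eval σ (y' 0)| := by
  simp [sameTime, hN.sat_isTime, eval_ptUp]

theorem sat_zeroTime [IsStrictOrderedRing Q] (x y : Pt) : N.Sat (zeroTime x y) β σ ↔
    N.eval σ (x 0) = N.eval σ (y 0) := by
  simp [zeroTime, hN.sat_isTime, hN.sat_isZero, eval_ptUp, sub_eq_zero]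

theorem sat_lightIff [IsStrictOrderedRing Q] (k : ℕ) (x y : Pt) (c : QTerm)
    (hc : 0 ≤ N.eval σ c) : N.Sat (lightIff k c x y) β σ ↔
      ((∃ p, N.ph p ∧ N.wv (β k) p (fun i => N.eval σ (x i)) ∧
        N.wv (β k) p (fun i => N.eval σ (y i))) ↔
      spaceSq (fun i => N.eval σ (x i)) (fun i => N.eval σ (y i)) =
        (N.eval σ c * (N.eval σ (x 0) - N.eval σ (y 0))) ^ 2) := by
  simp [lightIff, hN.sat_spaceEq _ _ _ _ _ hc]

end Notions

section Axioms

variable [Field Q] [LinearOrder Q] (hN : N.Standard) (β : ℕ → B) (σ : ℕ → Q)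

include hN

theorem sat_axSelf : N.Sat AxSelf β σ ↔
    ∀ k, N.iob k → ∀ x, N.wv k k x ↔ x 1 = 0 ∧ x 2 = 0 ∧ x 3 = 0 := by
  simp [AxSelf, hN.sat_isZero]

theorem sat_axSymD [IsStrictOrderedRing Q] : N.Sat AxSymD β σ ↔
    ∀ k k', N.iob k → N.iob k' → ∀ x y x' y', x 0 = y 0 → x' 0 = y' 0 → N.SameEv k x k' x' →
      N.SameEv k y k' y' → ∃ s, 0 ≤ s ∧ s ^ 2 = spaceSq x y ∧ s ^ 2 = spaceSq x' y' := by
  simp [AxSymD, hN.sat_zeroTime, hN.sat_sameSpace, ptVal_updPt_of_ne]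

theorem sat_axLine : N.Sat AxLine β σ ↔
    ∀ k h, N.iob k → N.iob h → ∀ x y z, N.wv k h x → N.wv k h y → N.wv k h z →
      ∃ a : Q, (∀ i, z i - x i = a * (y i - x i)) ∨ ∀ i, y i - z i = a * (z i - x i) := by
  have h₁ (a x y z : Q) : z - x = a * (y - x) ↔ z + a * x = x + a * y := by
    constructor <;> intro h <;> linear_combination h
  have h₂ (a x y z : Q) : y - z = a * (z - x) ↔ y + a * x = z + a * z := by
    constructor <;> intro h <;> linear_combination h
  simp [AxLine, hN.add, hN.mul, ptVal_updPt_of_ne, ptVal_update_of_ne, Fin.forall_fin_succ, h₁, h₂]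

theorem sat_axAbsTime [IsStrictOrderedRing Q] : N.Sat AxAbsTime β σ ↔
    ∀ k k', N.iob k → N.iob k' → ∀ x y x' y', N.SameEv k x k' x' →
      N.SameEv k y k' y' → |x 0 - y 0| = |x' 0 - y' 0| := by
  simp [AxAbsTime, hN.sat_sameTime, ptVal_updPt_of_ne]

theorem sat_axEther [IsStrictOrderedRing Q] : N.Sat AxEther β σ ↔
    ∃ e, N.iob e ∧ ∃ c, 0 < c ∧ N.LightSpeed e c := by
  simp only [AxEther, ether, sat_exB, sat_bindB, sat_and, sat_iob, Function.update_self, sat_exQ,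
    sat_bindQ, hN.sat_pos, eval_var]
  refine exists_congr fun e => and_congr_right fun _ => exists_congr fun c =>
    and_congr_right fun hc => ?_
  simp only [sat_allQs_ptVars_append, sat_allQs_ptVars]
  refine forall_congr' fun x => forall_congr' fun y => ?_
  rw [hN.sat_lightIff]
  · simp [ptVal_updPt_of_ne, updPt_of_ne]
  · simp [updPt_of_ne, hc.le]

theorem sat_isLightSpeed [IsStrictOrderedRing Q] : N.Sat isLightSpeed β σ ↔
    0 < σ 16 ∧ ∀ k, N.iob k → N.LightSpeed k (σ 16) := by
  simp only [isLightSpeed, sat_allB, sat_bindB, sat_and, sat_iob, Function.update_self,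
    hN.sat_pos, eval_var, sat_imp]
  refine and_congr_right fun hc => forall_congr' fun k => imp_congr_right fun _ => ?_
  simp only [sat_allQs_ptVars_append, sat_allQs_ptVars]
  refine forall_congr' fun x => forall_congr' fun y => ?_
  rw [hN.sat_lightIff]
  · simp [ptVal_updPt_of_ne, updPt_of_ne]
  · simp [updPt_of_ne, hc.le]

theorem sat_axPhc [IsStrictOrderedRing Q] : N.Sat AxPhc β σ ↔
    ∃ c, 0 < c ∧ ∀ k, N.iob k → N.LightSpeed k c := by
  simp [AxPhc, hN.sat_isLightSpeed]

theorem sat_axThExp [IsStrictOrderedRing Q] (h : (∃ k, N.iob k) ∧ ∀ c, 0 < c →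
    (∀ k, N.iob k → N.LightSpeed k c) → ∀ k, N.iob k → ∀ x y,
      spaceSq x y < (c * (x 0 - y 0)) ^ 2 → ∃ k', N.iob k' ∧ N.wv k k' x ∧ N.wv k k' y) :
    N.Sat AxThExp β σ := by
  simp only [AxThExp, sat_and, sat_exB, sat_bindB, sat_iob, Function.update_self, sat_allB, sat_imp,
    sat_allQs_ptVars_append, sat_allQs_ptVars, sat_exQ, sat_bindQ, hN.sat_isLightSpeed, sat_wv]
  refine ⟨h.1, ?_⟩
  rintro k hk x y ⟨c, ⟨hc, hc'⟩, hxy⟩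
  have := h.2 c hc hc' k hk x y
  replace hxy := hN.sat_spaceLt _ _ _ _ _ hxy
  simp [ptVal_updPt_of_ne, ptVal_update_of_ne] at hxy ⊢
  exact this hxy

end Axioms

end Standard

end Model

end Kinematics
-- Ordered fields from their axioms; criteria for `AxEField` and `AxTriv`
namespace Kinematics

namespace Model

variable {B Q : Type} {N : Model B Q}

/-- A field with a compatible linear order, given by its operations, its order and the axioms. -/
theorem exists_orderedField (add mul : Q → Q → Q) (le : Q → Q → Prop)
    (add_assoc : ∀ x y z, add (add x y) z = add x (add y z)) (add_comm : ∀ x y, add x y = add y x)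
    (mul_assoc : ∀ x y z, mul (mul x y) z = mul x (mul y z)) (mul_comm : ∀ x y, mul x y = mul y x)
    (mul_add : ∀ x y z, mul x (add y z) = add (mul x y) (mul x z)) (o i : Q) (ne : o ≠ i)
    (add_zero : ∀ x, add x o = x) (mul_one : ∀ x, mul x i = x) (add_neg : ∀ x, ∃ y, add x y = o)
    (mul_inv : ∀ x, x ≠ o → ∃ y, mul x y = i) (le_refl : ∀ x, le x x)
    (le_antisymm : ∀ x y, le x y → le y x → x = y) (le_trans : ∀ x y z, le x y → le y z → le x z)
    (le_total : ∀ x y, le x y ∨ le y x) (add_le : ∀ x y z, le x y → le (add x z) (add y z))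
    (mul_nonneg : ∀ x y, le o x → le o y → le o (mul x y)) :
    ∃ (_ : Field Q) (_ : LinearOrder Q), IsStrictOrderedRing Q ∧ (∀ x y, add x y = x + y) ∧
      (∀ x y, mul x y = x * y) ∧ ∀ x y, le x y ↔ x ≤ y := by
  classical
  choose neg add_neg using add_neg
  -- The axioms say nothing about the inverse of zero; it is chosen to be zero, as `Field` demands.
  have mul_inv' (x : Q) : ∃ y, (x ≠ o → mul x y = i) ∧ (x = o → y = o) := by
    by_cases h : x = o
    · exact ⟨o, by simp [h]⟩
    · obtain ⟨y, hy⟩ := mul_inv x h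
      exact ⟨y, by simp [h, hy]⟩
  choose inv mul_inv' using mul_inv'
  let : Add Q := ⟨add⟩
  let : Mul Q := ⟨mul⟩
  let : Neg Q := ⟨neg⟩
  let : Inv Q := ⟨inv⟩
  let : Zero Q := ⟨o⟩
  let : One Q := ⟨i⟩
  let F : Field Q := Field.ofMinimalAxioms Q add_assoc
    (fun a => (add_comm _ _).trans (add_zero a)) (fun a => (add_comm _ _).trans (add_neg a))
    mul_assoc mul_comm (fun a => (mul_comm _ _).trans (mul_one a)) (fun a h => (mul_inv' a).1 h)
    ((mul_inv' o).2 rfl) mul_add ⟨o, i, ne⟩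
  let L : LinearOrder Q :=
    { le := le
      le_refl := le_refl
      le_trans := le_trans
      le_antisymm := le_antisymm
      le_total := le_total
      toDecidableLE := Classical.decRel _ }
  have hmul (x y : Q) (hx : 0 ≤ x) (hy : 0 ≤ y) : 0 ≤ x * y := mul_nonneg x y hx hy
  have : IsOrderedAddMonoid Q :=
    { add_le_add_left := fun a b h c => add_le a b c h }
  -- If `1 ≤ 0` then `0 ≤ -1`, and the square of `-1` is `1`.
  have : ZeroLEOneClass Q := ⟨by
    rcases le_total (0 : Q) 1 with h | h
    · exact h
    · have h' : (0 : Q) ≤ -1 := neg_nonneg.2 h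
      simpa using hmul _ _ h' h'⟩
  refine ⟨F, L, ?_, fun _ _ => rfl, fun _ _ => rfl, fun _ _ => Iff.rfl⟩
  exact IsStrictOrderedRing.of_mul_pos fun a b ha hb =>
    lt_of_le_of_ne (hmul a b ha.le hb.le) (mul_ne_zero ha.ne' hb.ne').symm

/-- The operations of an interpreted model come from the translation and may differ from the
original ones on `Q`, so the field and its order have to be rebuilt from the axioms. -/
theorem exists_standard {β : ℕ → B} {σ : ℕ → Q} (h : N.Sat AxEField β σ) :
    ∃ (_ : Field Q) (_ : LinearOrder Q), IsStrictOrderedRing Q ∧ N.Standard := by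
  simp only [AxEField, sat_allQs_cons, sat_exQs_cons, nonneg, eval_up, isZero, sat_and,
    sat_imp, sat_eqQ, sat_allQs_nil, sat_exQs_nil, eval_add, eval_mul, eval_var, sat_allQ,
    sat_exQ, sat_neg, sat_or, sat_le] at h
  simp at h
  obtain ⟨h₁, h₂, h₃, h₄, h₅, ⟨o, i, ne, h₆, h₇, h₈, h₉⟩, h₁₀, h₁₁, h₁₂, h₁₃, h₁₄, h₁₅, -⟩ := h
  obtain ⟨F, L, hS, ha, hm, hl⟩ := exists_orderedField N.add N.mul N.le h₁ h₂ h₃ h₄ h₅ o i ne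
    h₆ h₇ h₈ h₉ h₁₀ h₁₁ h₁₂ h₁₃ h₁₄ (by
      intro x y hx hy
      obtain ⟨o', ho', h⟩ := h₁₅ x y o h₆ hx o h₆ hy
      -- The formula `nonneg` speaks of some neutral element of addition; any such element is `o`.
      have : o' = o := by rw [← ho' o, h₂, h₆]
      rwa [this] at h)
  exact ⟨F, L, hS, ha, hm, hl⟩

namespace Standard

variable [Field Q] [LinearOrder Q] [IsStrictOrderedRing Q] (hN : N.Standard)
  (β : ℕ → B) (σ : ℕ → Q)
include hN

theorem sat_axEField (h : ∀ x : Q, 0 < x → ∃ y, y * y = x) : N.Sat AxEField β σ := by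
  simp only [AxEField, sat_allQs_cons, sat_exQs_cons, sat_and, hN.sat_nonneg, hN.sat_pos,
    sat_imp, sat_eqQ, sat_allQs_nil, sat_exQs_nil, eval_add, eval_mul, eval_var,
    sat_neg, sat_or, sat_le, hN.add, hN.mul, hN.le]
  simp
  refine ⟨fun x y z => add_assoc x y z, add_comm, mul_assoc, mul_comm, mul_add, ⟨1, ?_⟩,
    fun x y => le_antisymm, fun x y z => le_trans, le_total, fun x y => mul_nonneg, h⟩
  exact ⟨zero_ne_one, mul_one, fun x => ⟨-x, add_neg_cancel x⟩,
    fun x hx => ⟨x⁻¹, mul_inv_cancel₀ hx⟩⟩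

omit [IsStrictOrderedRing Q] in
theorem sat_axTriv (h : ∀ (A : Fin 3 → Fin 3 → Q) (b : Fin 3 → Q) (t : Q),
    (∀ x : Fin 4 → Q, ∑ i, (A i 0 * x 1 + A i 1 * x 2 + A i 2 * x 3) ^ 2 =
      x 1 ^ 2 + x 2 ^ 2 + x 3 ^ 2) → ∀ k, N.iob k → ∃ k', N.iob k' ∧ ∀ x y, N.SameEv k x k' y ↔
      y 0 = x 0 + t ∧ ∀ i : Fin 3, y i.succ = A i 0 * x 1 + A i 1 * x 2 + A i 2 * x 3 + b i) :
    N.Sat AxTriv β σ := by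
  simp only [AxTriv, matApply, sat_allQs_cons, hN.add, hN.mul, sat_imp, sat_allQs_ptVars,
    sat_allQs_nil, sat_eqQ, eval_add, eval_mul, eval_var, eval_pt, sat_allB, sat_bindB, sat_iob]
  intro a₁ a₂ a₃ a₄ a₅ a₆ a₇ a₈ a₉ b₁ b₂ b₃ t hA k hk
  obtain ⟨k', hk', h'⟩ := h ![![a₁, a₂, a₃], ![a₄, a₅, a₆], ![a₇, a₈, a₉]] ![b₁, b₂, b₃] t
    (by
      intro x
      have := hA x
      simp [updPt_of_ne] at this
      simpa [Fin.sum_univ_three, sq] using this) k (by simpa using hk)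
  refine (sat_exB _ _ _).2 ⟨k', ?_⟩
  simp [hk', hN.add, hN.mul, ptVal_updPt_of_ne, updPt_of_ne, h', Fin.forall_fin_succ]

end Standard

/-! ## Speed in classical kinematics -/

/-- An automorphism moves the observer and the photons but leaves coordinates and `c` alone. -/
theorem IsAut.lightSpeed [Ring Q] {g : B ≃ B} (hg : N.IsAut g) {e : B} {c : Q}
    (h : N.LightSpeed e c) : N.LightSpeed (g e) c := by
  intro x y
  rw [← h x y, ← g.exists_congr_right]
  simp [hg.ph, hg.wv]

/-- Both sides are quadratic in the displacement, so the squared speed is the same for proportional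
displacements. The two alternatives in the hypothesis are those of `AxLine`; the second says `y - x
= (1 + a) (z - x)`. -/
theorem spaceSq_of_collinear [Field Q] {x y z : Fin 4 → Q}
    (h : ∃ a, (∀ i, z i - x i = a * (y i - x i)) ∨ ∀ i, y i - z i = a * (z i - x i))
    (hy : x 0 ≠ y 0) {s : Q} (hs : spaceSq x y = s * (x 0 - y 0) ^ 2) :
    spaceSq x z = s * (x 0 - z 0) ^ 2 := by
  simp only [spaceSq] at *
  obtain ⟨a, h | h⟩ := h
  · have h' (i) : z i = x i + a * (y i - x i) := by linear_combination h i
    simp only [h']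
    linear_combination a ^ 2 * hs
  · have h' (i) : y i = x i + (1 + a) * (z i - x i) := by linear_combination h i
    simp only [h'] at hs hy
    -- If `1 + a` vanished, `y` would equal `x`, against `x 0 ≠ y 0`.
    have ha : (1 + a) ^ 2 ≠ 0 := by
      intro ha
      simp [pow_eq_zero_iff two_ne_zero |>.1 ha] at hy
    refine mul_left_cancel₀ ha ?_
    linear_combination hs

section Classical

variable [Field Q] [LinearOrder Q] [IsStrictOrderedRing Q]
  (hEv : ∀ k h, N.iob k → N.iob h → ∀ x, ∃ y, N.SameEv k x h y)
  (hSymD : ∀ k k', N.iob k → N.iob k' → ∀ x y x' y', x 0 = y 0 → x' 0 = y' 0 →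
    N.SameEv k x k' x' → N.SameEv k y k' y' → spaceSq x y = spaceSq x' y')
  (hTime : ∀ k k', N.iob k → N.iob k' → ∀ x y x' y', N.SameEv k x k' x' →
    N.SameEv k y k' y' → |x 0 - y 0| = |x' 0 - y' 0|)
include hEv hSymD hTime

/-- Ether observers agree on the spatial distance of any two events. -/
theorem spaceSq_eq_of_lightSpeed {e e' : B} {c c' : Q} (he : N.iob e) (he' : N.iob e')
    (hc : c ≠ 0) (hl : N.LightSpeed e c) (hl' : N.LightSpeed e' c') {x y x' y' : Fin 4 → Q}
    (hx : N.SameEv e x e' x') (hy : N.SameEv e y e' y') : spaceSq x y = spaceSq x' y' := by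
  have htime : ∀ {u v u' v'}, N.SameEv e u e' u' → N.SameEv e v e' v' →
      (u 0 = v 0 ↔ u' 0 = v' 0) := by
    intro u v u' v' hu hv
    rw [← sub_eq_zero, ← abs_eq_zero, hTime e e' he he' u v u' v' hu hv, abs_eq_zero, sub_eq_zero]
  by_cases ht : x 0 = y 0
  · exact hSymD e e' he he' x y x' y' ht ((htime hx hy).1 ht) hx hy
  -- The event at the place of `x` according to `e`, at the time of `y`; `a` is its position for
  -- `e'`. The aim is that `a` and `x'` have the same place for `e'`, that is, `e'` sees no motion
  -- of `e`.
  obtain ⟨a, ha⟩ := hEv e e' he he' ![y 0, x 1, x 2, x 3]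
  have hx₀ (z : Fin 4 → Q) : spaceSq x z = spaceSq ![y 0, x 1, x 2, x 3] z := rfl
  have ha₀ : a 0 = y' 0 := (htime ha hy).1 rfl
  set r := c * (x 0 - y 0) with hr
  have hr₀ : r ≠ 0 := mul_ne_zero hc (sub_ne_zero.2 ht)
  -- For `e`, light from `x` reaches at the time of `y` the sphere of radius `|r|` about the place
  -- of `x`. By `AxSymD` this is for `e'` the sphere of radius `|r|` about `a`; as `e'` is an ether
  -- observer too, its points are equidistant from the place of `x'`.
  have key (p : Fin 4 → Q) (hp₀ : a 0 = p 0) (hp : spaceSq a p = r ^ 2) :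
      spaceSq x' p = (c' * (x' 0 - a 0)) ^ 2 := by
    obtain ⟨z, hz⟩ := hEv e' e he' he p
    replace hz : N.SameEv e z e' p := fun b => (hz b).symm
    have hz₀ : y 0 = z 0 := (htime ha hz).2 hp₀
    have h := hSymD e e' he he' ![y 0, x 1, x 2, x 3] z a p hz₀ hp₀ ha hz
    obtain ⟨q, hq, h₁, h₂⟩ := (hl x z).2 (by rw [← hz₀, ← hr, ← hp, ← h, hx₀])
    rw [hp₀]
    exact (hl' x' p).1 ⟨q, hq, (hx q).1 h₁, (hz q).1 h₂⟩
  -- Opposite points of the sphere on each axis. Subtracting the two equations for an axis gives `4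
  -- r (x' i - a i) = 0`, so the two centres coincide.
  have h₁ := key ![a 0, a 1 + r, a 2, a 3] rfl (by simp [spaceSq])
  have h₁' := key ![a 0, a 1 - r, a 2, a 3] rfl (by simp [spaceSq])
  have h₂ := key ![a 0, a 1, a 2 + r, a 3] rfl (by simp [spaceSq])
  have h₂' := key ![a 0, a 1, a 2 - r, a 3] rfl (by simp [spaceSq])
  have h₃ := key ![a 0, a 1, a 2, a 3 + r] rfl (by simp [spaceSq])
  have h₃' := key ![a 0, a 1, a 2, a 3 - r] rfl (by simp [spaceSq])
  simp [spaceSq] at h₁ h₁' h₂ h₂' h₃ h₃'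
  have hr₄ : 4 * r ≠ 0 := mul_ne_zero four_ne_zero hr₀
  have e₁ : x' 1 = a 1 := mul_left_cancel₀ hr₄ (by linear_combination h₁' - h₁)
  have e₂ : x' 2 = a 2 := mul_left_cancel₀ hr₄ (by linear_combination h₂' - h₂)
  have e₃ : x' 3 = a 3 := mul_left_cancel₀ hr₄ (by linear_combination h₃' - h₃)
  -- The distance from `x` to `y` is now a distance of simultaneous events, on which `e` and `e'`
  -- agree.
  have h := hSymD e e' he he' ![y 0, x 1, x 2, x 3] y a y' rfl ha₀ ha hy
  rw [hx₀, h]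
  simp only [spaceSq, e₁, e₂, e₃]

omit hEv hSymD hTime [IsStrictOrderedRing Q] in
variable (N) in
/-- According to some ether observer, `b` moves with a speed the square of which is `s`. -/
def HasSpeedSq (b : B) (s : Q) : Prop :=
  ∃ e, N.iob e ∧ (∃ c, 0 < c ∧ N.LightSpeed e c) ∧ ∃ x y, x 0 ≠ y 0 ∧ N.wv e b x ∧ N.wv e b y ∧
    spaceSq x y = s * (x 0 - y 0) ^ 2

omit hEv hSymD hTime [IsStrictOrderedRing Q] in
-- The automorphism replaces the ether observer by another one; this is why the notion quantifies
-- over ether observers instead of fixing one.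
theorem HasSpeedSq.map {g : B ≃ B} (hg : N.IsAut g) {b : B} {s : Q} (h : N.HasSpeedSq b s) :
    N.HasSpeedSq (g b) s := by
  obtain ⟨e, he, ⟨c, hc, hl⟩, x, y, h⟩ := h
  exact ⟨g e, (hg.iob e).2 he, ⟨c, hc, hg.lightSpeed hl⟩, x, y, by simpa only [hg.wv] using h⟩

/-- The events measured by `e` are transferred to `e'`, preserving distances in space and time. Both
measurements then concern one straight world-line, on which the ratio of distance to time is
constant. -/
theorem HasSpeedSq.unique (hLine : ∀ k h, N.iob k → N.iob h → ∀ x y z, N.wv k h x → N.wv k h y →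
      N.wv k h z → ∃ a : Q, (∀ i, z i - x i = a * (y i - x i)) ∨ ∀ i, y i - z i = a * (z i - x i))
    {b : B} (hb : N.iob b) {s s' : Q} (h : N.HasSpeedSq b s) (h' : N.HasSpeedSq b s') :
    s = s' := by
  obtain ⟨e, he, ⟨c, hc, hl⟩, x, y, hxy, hx, hy, hs⟩ := h
  obtain ⟨e', he', ⟨c', hc', hl'⟩, x', y', hxy', hx', hy', hs'⟩ := h'
  obtain ⟨u, hu⟩ := hEv e e' he he' x
  obtain ⟨v, hv⟩ := hEv e e' he he' y
  have ht := hTime e e' he he' x y u v hu hv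
  have huv : u 0 ≠ v 0 := by
    rwa [← sub_ne_zero, ← abs_ne_zero, ← ht, abs_ne_zero, sub_ne_zero]
  rw [spaceSq_eq_of_lightSpeed hEv hSymD hTime he he' hc.ne' hl hl' hu hv, ← sq_abs, ht,
    sq_abs] at hs
  rw [hu b] at hx
  rw [hv b] at hy
  have symm (p q : Fin 4 → Q) (t : Q) (h : spaceSq p q = t * (p 0 - q 0) ^ 2) :
      spaceSq q p = t * (q 0 - p 0) ^ 2 := by
    simp only [spaceSq] at *
    linear_combination h
  have key (p q q' : Fin 4 → Q) (hp : N.wv e' b p) (hq : N.wv e' b q) (hq' : N.wv e' b q') (t)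
      (h₀ : p 0 ≠ q 0) (h : spaceSq p q = t * (p 0 - q 0) ^ 2) :
      spaceSq p q' = t * (p 0 - q' 0) ^ 2 :=
    spaceSq_of_collinear (hLine e' b he' hb p q q' hp hq hq') h₀ h
  have fin (p q : Fin 4 → Q) (h₀ : p 0 ≠ q 0) (h : spaceSq p q = s * (p 0 - q 0) ^ 2)
      (h' : spaceSq p q = s' * (p 0 - q 0) ^ 2) : s = s' :=
    mul_right_cancel₀ (pow_ne_zero 2 (sub_ne_zero.2 h₀)) (h.symm.trans h')
  -- The two measurements are compared on a pair of events at different times. Since `x'` and `y'`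
  -- have different times, at least one of them differs in time from `u`.
  by_cases h : u 0 = x' 0
  · have h₁ : u 0 ≠ y' 0 := h ▸ hxy'
    exact fin u y' h₁ (key u v y' hx hy hy' s huv hs)
      (symm _ _ _ (key y' x' u hy' hx' hx s' hxy'.symm (symm _ _ _ hs')))
  · exact fin u x' h (key u v x' hx hy hx' s huv hs)
      (symm _ _ _ (key x' y' u hx' hy' hx s' hxy' hs'))

end Classical

/-- In a model of classical kinematics, the automorphisms fixing all quantities have at least three
orbits. -/
theorem exists_inequivalent_bodies (hN : ∀ φ ∈ ClassicalKinFull, ∀ β σ, N.Sat φ β σ)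
    [Nonempty B] [Nonempty Q] :
    ∃ b : Fin 3 → B, ∀ g, N.IsAut g → ∀ i j, g (b i) = b j → i = j := by
  obtain ⟨b₀⟩ := ‹Nonempty B›
  obtain ⟨q₀⟩ := ‹Nonempty Q›
  replace hN (φ) (h : φ ∈ ClassicalKinFull) := hN φ h (fun _ => b₀) (fun _ => q₀)
  obtain ⟨_, _, _, hS⟩ := exists_standard (hN AxEField (by simp [ClassicalKinFull, KinFull]))
  have hEv := (sat_axEv _ _).1 (hN AxEv (by simp [ClassicalKinFull, KinFull]))
  have hSymD := (hS.sat_axSymD _ _).1 (hN AxSymD (by simp [ClassicalKinFull, KinFull]))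
  have hLine := (hS.sat_axLine _ _).1 (hN AxLine (by simp [ClassicalKinFull, KinFull]))
  have hTime := (hS.sat_axAbsTime _ _).1 (hN AxAbsTime (by simp [ClassicalKinFull]))
  have hExp := (sat_axThExpPlus _ _).1 (hN AxThExpPlus (by simp [ClassicalKinFull]))
  obtain ⟨e, he, hl⟩ := (hS.sat_axEther _ _).1 (hN AxEther (by simp [ClassicalKinFull]))
  -- An observer through the origin and `(1, i, 0, 0)` has speed `i` relative to the ether; no upper
  -- bound on speeds is imposed by `AxThExpPlus`.
  have hex (i : Fin 3) : ∃ b, N.iob b ∧ N.HasSpeedSq b (((i : ℕ) : Q) ^ 2) := by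
    obtain ⟨b, hb, h₁, h₂⟩ := hExp.2 e he ![0, 0, 0, 0] ![1, ((i : ℕ) : Q), 0, 0] (by simp)
    exact ⟨b, hb, e, he, hl, _, _, by simp, h₁, h₂, by simp [spaceSq]⟩
  choose b hb hs using hex
  refine ⟨b, fun g hg i j hij => ?_⟩
  have h := (hs i).map hg
  rw [hij] at h
  have := HasSpeedSq.unique hEv (fun k k' hk hk' x y x' y' h₁ h₂ h₃ h₄ => by
    obtain ⟨s, -, h, h'⟩ := hSymD k k' hk hk' x y x' y' h₁ h₂ h₃ h₄
    exact h.symm.trans h') hTime hLine (hb j) h (hs j)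
  rw [sq_eq_sq₀ (Nat.cast_nonneg _) (Nat.cast_nonneg _), Nat.cast_inj] at this
  exact Fin.ext this

end Model

end Kinematics
namespace Kinematics

/-! ## A model of special relativity -/

/-- The square of the Minkowski length. -/
def minkSq (v : Fin 4 → ℝ) : ℝ := v 0 ^ 2 - v 1 ^ 2 - v 2 ^ 2 - v 3 ^ 2

theorem minkSq_smul (a : ℝ) (v : Fin 4 → ℝ) : minkSq (a • v) = a ^ 2 * minkSq v := by
  simp [minkSq]; ring

theorem minkSq_sub (x y : Fin 4 → ℝ) : minkSq (x - y) = (x 0 - y 0) ^ 2 - spaceSq x y := by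
  simp [minkSq, spaceSq]; ring

theorem minkSq_sub_comm (x y : Fin 4 → ℝ) : minkSq (x - y) = minkSq (y - x) := by
  simp [minkSq]; ring

/-- The Poincaré group. -/
def poincare : Subgroup ((Fin 4 → ℝ) ≃ᵃ[ℝ] (Fin 4 → ℝ)) where
  carrier := {f | ∀ v, minkSq (f.linear v) = minkSq v}
  mul_mem' {f g} hf hg v := (hf (g.linear v)).trans (hg v)
  one_mem' _ := rfl
  inv_mem' {f} hf v := by
    have h := hf (f⁻¹.linear v)
    rw [← h]
    congr 1
    exact f.linear.apply_symm_apply v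

/-! ### Poincaré transformations moving one line to another -/

namespace poincare

theorem minkSq_sub (g : poincare) (x y : Fin 4 → ℝ) :
    minkSq (g.1 x - g.1 y) = minkSq (x - y) := by
  rw [← g.2 (x - y)]
  congr 1
  exact (g.1.toAffineMap.linearMap_vsub x y).symm

theorem apply_smul (g : poincare) (t : ℝ) (v : Fin 4 → ℝ) :
    g.1 (t • v) = g.1 0 + t • g.1.linear v := by
  have := g.1.map_vadd 0 (t • v)
  simp only [vadd_eq_add, add_zero, map_smul] at this
  rw [this, add_comm]

theorem exists_apply_eq_add (L : (Fin 4 → ℝ) ≃ₗ[ℝ] (Fin 4 → ℝ))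
    (hL : ∀ v, minkSq (L v) = minkSq v) (p : Fin 4 → ℝ) : ∃ g : poincare, ∀ v, g.1 v = p + L v :=
  ⟨⟨L.toAffineEquiv.trans (AffineEquiv.constVAdd ℝ _ p), hL⟩, fun _ => rfl⟩

/-- The reflection interchanging two vectors of the same Minkowski length. -/
theorem exists_reflection {a b : Fin 4 → ℝ} (h : minkSq a = minkSq b)
    (hab : minkSq (b - a) ≠ 0) :
    ∃ L : (Fin 4 → ℝ) ≃ₗ[ℝ] (Fin 4 → ℝ), (∀ v, minkSq (L v) = minkSq v) ∧ L a = b := by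
  set n := b - a with hn
  -- Writing `⟨·,·⟩` for the Minkowski product, `f v = 2⟨n, v⟩ / ⟨n, n⟩`, so that `v - f v • n` is
  -- the reflection along `n`. Equality of the lengths of `a` and `b` gives `2⟨n, a⟩ = -⟨n, n⟩`,
  -- hence `f a = -1` and `a ↦ a + n = b`.
  let f : Module.Dual ℝ (Fin 4 → ℝ) := (2 / minkSq n) • (n 0 • LinearMap.proj 0 -
    n 1 • LinearMap.proj 1 - n 2 • LinearMap.proj 2 - n 3 • LinearMap.proj 3)
  have hf (v) : f v = 2 / minkSq n * (n 0 * v 0 - n 1 * v 1 - n 2 * v 2 - n 3 * v 3) := by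
    simp [f]
  have hf' (v) : f v * minkSq n = 2 * (n 0 * v 0 - n 1 * v 1 - n 2 * v 2 - n 3 * v 3) := by
    rw [hf]; field_simp
  have hfn : f n = 2 := mul_right_cancel₀ hab (by rw [hf']; simp only [minkSq]; ring)
  have hfa : f a = -1 := mul_right_cancel₀ hab (by
    rw [hf']
    simp only [minkSq, hn, Pi.sub_apply] at h ⊢
    linear_combination - h)
  refine ⟨Module.reflection hfn, fun v => ?_, ?_⟩
  · have := hf' v
    rw [Module.reflection_apply]
    simp only [minkSq, Pi.sub_apply, Pi.smul_apply, smul_eq_mul] at this ⊢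
    linear_combination f v * this
  · rw [Module.reflection_apply, hfa, hn]
    simp

/-- A line can be moved to every line with a direction of the same Minkowski length. -/
theorem exists_map_line (p : Fin 4 → ℝ) {d m : Fin 4 → ℝ} (h : minkSq m = minkSq d)
    (hd : minkSq (d - m) = 0 → d = m) : ∃ g : poincare, ∀ t : ℝ, g.1 (t • m) = p + t • d := by
  obtain ⟨L, hL, hm⟩ : ∃ L : (Fin 4 → ℝ) ≃ₗ[ℝ] (Fin 4 → ℝ),
      (∀ v, minkSq (L v) = minkSq v) ∧ L m = d := by
    -- There is no reflection along a null vector; in that case `hd` makes the identity suffice.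
    by_cases h' : minkSq (d - m) = 0
    · exact ⟨.refl ℝ _, fun _ => rfl, (hd h').symm⟩
    · exact exists_reflection h h'
  obtain ⟨g, hg⟩ := exists_apply_eq_add L hL p
  exact ⟨g, fun t => by rw [hg, map_smul, hm]⟩

end poincare

/-- The direction of the time axis. -/
def timeDir : Fin 4 → ℝ := ![1, 0, 0, 0]

/-- The direction of a light signal. -/
def lightDir : Fin 4 → ℝ := ![1, 1, 0, 0]

/-- The world-line of a body: a Poincaré transformation `g` is taken both for an inertial observer,
with the image of the time axis as its world-line, and for a photon. -/
def worldLine : poincare ⊕ poincare → Set (Fin 4 → ℝ)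
  | .inl g => Set.range fun t : ℝ => g.1 (t • timeDir)
  | .inr g => Set.range fun t : ℝ => g.1 (t • lightDir)

/-- The model of special relativity over the real numbers in which the inertial coordinate systems are
the Poincaré transformations. -/
def minkowski : Model (poincare ⊕ poincare) ℝ where
  iob k := k.isLeft
  ph p := p.isRight
  wv k b x := ∃ g : poincare, k = .inl g ∧ g.1 x ∈ worldLine b
  le := (· ≤ ·)
  add := (· + ·)
  mul := (· * ·)

/-! ### The axioms of special relativity and the automorphisms in the Minkowski model -/

namespace minkowski

open poincare

theorem iob_iff (k : poincare ⊕ poincare) : minkowski.iob k ↔ ∃ g, k = .inl g := by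
  cases k <;> simp [minkowski]

theorem ph_iff (k : poincare ⊕ poincare) : minkowski.ph k ↔ ∃ g, k = .inr g := by
  cases k <;> simp [minkowski]

theorem wv_inl (g : poincare) (b : poincare ⊕ poincare) (x : Fin 4 → ℝ) :
    minkowski.wv (.inl g) b x ↔ g.1 x ∈ worldLine b := by
  simp [minkowski]

theorem standard : minkowski.Standard :=
  ⟨fun _ _ => rfl, fun _ _ => rfl, fun _ _ => Iff.rfl⟩

/-- A point is determined by the bodies present there: a translate of the time axis and a light line
through the point meet nowhere else. -/
theorem sameEv_iff (k h : poincare) (x y : Fin 4 → ℝ) :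
    minkowski.SameEv (.inl k) x (.inl h) y ↔ k.1 x = h.1 y := by
  constructor
  · intro H
    simp only [Model.SameEv, wv_inl] at H
    obtain ⟨g, hg⟩ := exists_apply_eq_add (.refl ℝ _) (fun _ => rfl) (k.1 x)
    have h₁ := (H (.inl g)).1 ⟨0, by simp [hg]⟩
    have h₂ := (H (.inr g)).1 ⟨0, by simp [hg]⟩
    obtain ⟨t, ht⟩ := h₁
    obtain ⟨s, hs⟩ := h₂
    simp only [hg] at ht hs
    -- Only the light line moves in the first space direction, so its parameter `s` is zero.
    have h₃ := congrFun (ht.trans hs.symm) 1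
    simp [timeDir, lightDir] at h₃
    simpa [h₃] using hs
  · intro H b
    rw [wv_inl, wv_inl, H]

/-- Photon lines are the images of one null line, so differences along them are null. Conversely a
nonzero null vector has nonzero time component; scaled to time component 1 it can be matched with
`lightDir`. -/
theorem lightSpeed (k : poincare) : minkowski.LightSpeed (.inl k) 1 := by
  intro x y
  have hxy : spaceSq x y = (1 * (x 0 - y 0)) ^ 2 ↔ minkSq (k.1 y - k.1 x) = 0 := by
    rw [minkSq_sub_comm, poincare.minkSq_sub, Kinematics.minkSq_sub]
    constructor <;> intro h <;> linarith
  rw [hxy]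
  constructor
  · rintro ⟨p, hp, hx, hy⟩
    obtain ⟨g, rfl⟩ := (ph_iff p).1 hp
    rw [wv_inl] at hx hy
    obtain ⟨t, ht⟩ := hx
    obtain ⟨s, hs⟩ := hy
    simp only at ht hs
    rw [← ht, ← hs, poincare.minkSq_sub, ← sub_smul, minkSq_smul]
    simp [minkSq, lightDir]
  · intro h
    set d := k.1 y - k.1 x with hd
    obtain ⟨g, a, hg, ha⟩ : ∃ (g : poincare) (a : ℝ), g.1 0 = k.1 x ∧ g.1 (a • lightDir) = k.1 y := by
      by_cases h₀ : d 0 = 0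
      · have h₁ : d = 0 := by
          simp only [minkSq, h₀] at h
          have e₁ : d 1 = 0 := by nlinarith [sq_nonneg (d 1), sq_nonneg (d 2), sq_nonneg (d 3)]
          have e₂ : d 2 = 0 := by nlinarith [sq_nonneg (d 1), sq_nonneg (d 2), sq_nonneg (d 3)]
          have e₃ : d 3 = 0 := by nlinarith [sq_nonneg (d 1), sq_nonneg (d 2), sq_nonneg (d 3)]
          funext i
          fin_cases i <;> assumption
        obtain ⟨g, hg⟩ := exists_apply_eq_add (.refl ℝ _) (fun _ => rfl) (k.1 x)
        exact ⟨g, 0, by simp [hg], by rw [hd, sub_eq_zero] at h₁; simp [hg, h₁]⟩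
      -- With both vectors null and of time component 1, a null difference means that the spatial
      -- parts agree, so the vectors are equal.
      · obtain ⟨g, hg⟩ := exists_map_line (k.1 x) (d := (d 0)⁻¹ • d) (m := lightDir)
          (by rw [minkSq_smul, h]; simp [minkSq, lightDir]) (by
            intro h'
            have hq : minkSq ((d 0)⁻¹ • d) = 0 := by rw [minkSq_smul, h, mul_zero]
            have hz : ((d 0)⁻¹ • d) 0 = 1 := by simp [h₀]
            generalize (d 0)⁻¹ • d = u at *
            simp [minkSq, lightDir, hz] at hq h'
            have e₁ : u 1 = 1 := by nlinarith [sq_nonneg (u 1 - 1), sq_nonneg (u 2), sq_nonneg (u 3)]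
            have e₂ : u 2 = 0 := by nlinarith [sq_nonneg (u 1 - 1), sq_nonneg (u 2), sq_nonneg (u 3)]
            have e₃ : u 3 = 0 := by nlinarith [sq_nonneg (u 1 - 1), sq_nonneg (u 2), sq_nonneg (u 3)]
            funext i
            fin_cases i <;> simp [lightDir, *])
        exact ⟨g, d 0, by simpa using hg 0, by rw [hg, smul_smul, mul_inv_cancel₀ h₀, one_smul, hd, add_sub_cancel]⟩
    refine ⟨.inr g, rfl, ?_, ?_⟩ <;> rw [wv_inl]
    · exact ⟨0, by simp [hg]⟩
    · exact ⟨a, ha⟩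

/-- The difference of the two events is timelike, so scaling by its Minkowski length gives a unit
vector to which the time axis can be moved. -/
theorem exists_observer (k : poincare) {x y : Fin 4 → ℝ} (h : spaceSq x y < (x 0 - y 0) ^ 2) :
    ∃ g, minkowski.wv (.inl k) (.inl g) x ∧ minkowski.wv (.inl k) (.inl g) y := by
  have hpos : 0 < minkSq (k.1 y - k.1 x) := by
    rw [minkSq_sub_comm, poincare.minkSq_sub, Kinematics.minkSq_sub]
    linarith
  set d := k.1 y - k.1 x with hd
  set a := √(minkSq d) with ha
  have ha₀ : a ≠ 0 := (Real.sqrt_pos.2 hpos).ne'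
  have ha₁ : a ^ 2 = minkSq d := Real.sq_sqrt hpos.le
  obtain ⟨g, hg⟩ := exists_map_line (k.1 x) (d := a⁻¹ • d) (m := timeDir)
    (by rw [minkSq_smul, ← ha₁]; simp [minkSq, timeDir, ha₀]) (by
      intro h'
      have hq : minkSq (a⁻¹ • d) = 1 := by rw [minkSq_smul, ← ha₁]; simp [ha₀]
      generalize a⁻¹ • d = u at *
      simp [minkSq, timeDir] at hq h'
      -- If the difference from `timeDir` is null, `(u 0 - 1)²` equals the squared spatial length
      -- `(u 0)² - 1`.
      have e₀ : u 0 = 1 := by nlinarith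
      simp only [e₀] at hq
      have e₁ : u 1 = 0 := by nlinarith [sq_nonneg (u 1), sq_nonneg (u 2), sq_nonneg (u 3)]
      have e₂ : u 2 = 0 := by nlinarith [sq_nonneg (u 1), sq_nonneg (u 2), sq_nonneg (u 3)]
      have e₃ : u 3 = 0 := by nlinarith [sq_nonneg (u 1), sq_nonneg (u 2), sq_nonneg (u 3)]
      funext i
      fin_cases i <;> simp [timeDir, *])
  refine ⟨g, ?_, ?_⟩ <;> rw [wv_inl]
  · exact ⟨0, by simpa using hg 0⟩
  · exact ⟨a, by simp only [hg]; rw [smul_smul, mul_inv_cancel₀ ha₀, one_smul, hd, add_sub_cancel]⟩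

theorem exists_line (k : poincare) (h : poincare) :
    ∃ p d : Fin 4 → ℝ, ∀ x, minkowski.wv (.inl k) (.inl h) x → ∃ t : ℝ, x = p + t • d := by
  refine ⟨(k⁻¹ * h).1 0, (k⁻¹ * h).1.linear timeDir, fun x hx => ?_⟩
  obtain ⟨t, ht⟩ := (wv_inl _ _ _).1 hx
  refine ⟨t, Eq.trans ?_ (apply_smul (k⁻¹ * h) t timeDir)⟩
  exact (k.1.symm_apply_apply x).symm.trans (congrArg k.1.symm ht.symm)

/-- A length-preserving spatial matrix, extended by the identity on time, preserves the Minkowski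
form. It has trivial kernel, so it is invertible in finite dimension. -/
theorem exists_trivial (A : Fin 3 → Fin 3 → ℝ) (b : Fin 3 → ℝ) (t : ℝ)
    (hA : ∀ x : Fin 4 → ℝ, ∑ i, (A i 0 * x 1 + A i 1 * x 2 + A i 2 * x 3) ^ 2 =
      x 1 ^ 2 + x 2 ^ 2 + x 3 ^ 2) :
    ∃ g : poincare, ∀ x, g.1 x 0 = x 0 + t ∧
      ∀ i : Fin 3, g.1 x i.succ = A i 0 * x 1 + A i 1 * x 2 + A i 2 * x 3 + b i := by
  let L : (Fin 4 → ℝ) →ₗ[ℝ] (Fin 4 → ℝ) :=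
    { toFun := fun x => Fin.cons (x 0) fun i => A i 0 * x 1 + A i 1 * x 2 + A i 2 * x 3
      map_add' := fun x y => by
        funext i
        refine Fin.cases ?_ (fun i => ?_) i <;> simp
        ring
      map_smul' := fun c x => by
        funext i
        refine Fin.cases ?_ (fun i => ?_) i <;> simp
        ring }
  have h₀ (x) : L x 0 = x 0 := rfl
  have h₁ (x) (i : Fin 3) : L x i.succ = A i 0 * x 1 + A i 1 * x 2 + A i 2 * x 3 := rfl
  have hinj : Function.Injective L := by
    rw [← LinearMap.ker_eq_bot, LinearMap.ker_eq_bot']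
    intro x hx
    have h := hA x
    simp only [← h₁, hx] at h
    simp at h
    have e₀ : x 0 = 0 := (h₀ x).symm.trans (by rw [hx]; rfl)
    have e₁ : x 1 = 0 := by nlinarith [sq_nonneg (x 1), sq_nonneg (x 2), sq_nonneg (x 3)]
    have e₂ : x 2 = 0 := by nlinarith [sq_nonneg (x 1), sq_nonneg (x 2), sq_nonneg (x 3)]
    have e₃ : x 3 = 0 := by nlinarith [sq_nonneg (x 1), sq_nonneg (x 2), sq_nonneg (x 3)]
    funext i
    fin_cases i <;> assumption
  obtain ⟨g, hg⟩ := exists_apply_eq_add (LinearEquiv.ofInjectiveEndo L hinj) (fun v => by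
    have h := hA v
    rw [Fin.sum_univ_three, ← h₁, ← h₁, ← h₁] at h
    simp only [minkSq, LinearEquiv.coe_ofInjectiveEndo, h₀]
    change v 0 ^ 2 - L v (Fin.succ 0) ^ 2 - L v (Fin.succ 1) ^ 2 - L v (Fin.succ 2) ^ 2 = _
    linarith) (Fin.cons t b)
  refine ⟨g, fun x => ⟨?_, fun i => ?_⟩⟩ <;> rw [hg]
  · simp [h₀, add_comm]
  · simp [h₁, add_comm]

/-- Needed because `AxThExp` refers to any `c` that is a speed of light, not to a chosen one. -/
theorem lightSpeed_unique {c : ℝ} (hc : 0 < c) (h : ∀ k, minkowski.iob k → minkowski.LightSpeed k c) :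
    c = 1 := by
  have h₁ := (h (.inl 1) rfl 0 lightDir).symm.trans (lightSpeed 1 0 lightDir)
  simp [spaceSq, lightDir] at h₁
  nlinarith

/-- The Minkowski model satisfies the axioms of special relativity. -/
theorem sat_specRel : ∀ φ ∈ SpecRelFull, ∀ β σ, minkowski.Sat φ β σ := by
  have hS := standard
  intro φ hφ β σ
  simp only [SpecRelFull, KinFull, Set.union_insert, Set.union_singleton, Set.mem_insert_iff,
    Set.mem_singleton_iff] at hφ
  have hlight (k) (hk : minkowski.iob k) : minkowski.LightSpeed k 1 := by
    obtain ⟨k, rfl⟩ := (iob_iff k).1 hk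
    exact lightSpeed k
  rcases hφ with rfl | rfl | rfl | rfl | rfl | rfl | rfl | rfl | rfl
  · rw [hS.sat_axPhc]
    exact ⟨1, one_pos, hlight⟩
  · refine hS.sat_axThExp _ _ ⟨⟨.inl 1, rfl⟩, fun c hc h k hk x y hxy => ?_⟩
    obtain ⟨k, rfl⟩ := (iob_iff k).1 hk
    obtain rfl := lightSpeed_unique hc h
    rw [one_mul] at hxy
    obtain ⟨g, h⟩ := exists_observer k hxy
    exact ⟨.inl g, rfl, h⟩
  · exact hS.sat_axEField _ _ fun x hx => ⟨√x, Real.mul_self_sqrt hx.le⟩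
  · rw [Model.sat_axEv]
    intro k h hk hh x
    obtain ⟨k, rfl⟩ := (iob_iff k).1 hk
    obtain ⟨h, rfl⟩ := (iob_iff h).1 hh
    exact ⟨h.1.symm (k.1 x), (sameEv_iff _ _ _ _).2 (h.1.apply_symm_apply _).symm⟩
  · rw [hS.sat_axSelf]
    intro k hk x
    obtain ⟨k, rfl⟩ := (iob_iff k).1 hk
    rw [wv_inl]
    simp only [worldLine, Set.mem_range, EmbeddingLike.apply_eq_iff_eq]
    constructor
    · rintro ⟨t, rfl⟩
      simp [timeDir]
    · rintro ⟨h₁, h₂, h₃⟩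
      refine ⟨x 0, ?_⟩
      funext i
      fin_cases i <;> simp [timeDir, *]
  · rw [hS.sat_axSymD]
    intro k k' hk hk' x y x' y' h₀ h₀' hx hy
    obtain ⟨k, rfl⟩ := (iob_iff k).1 hk
    obtain ⟨k', rfl⟩ := (iob_iff k').1 hk'
    rw [sameEv_iff] at hx hy
    -- For simultaneous events the Minkowski square is minus the squared spatial distance, so
    -- invariance of the former gives `AxSymD`.
    have h := poincare.minkSq_sub k x y
    rw [hx, hy, poincare.minkSq_sub, Kinematics.minkSq_sub, Kinematics.minkSq_sub, h₀, h₀'] at h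
    have hnn : 0 ≤ spaceSq x y := by unfold spaceSq; positivity
    refine ⟨√(spaceSq x y), Real.sqrt_nonneg _, Real.sq_sqrt hnn, ?_⟩
    rw [Real.sq_sqrt hnn]
    linarith
  · rw [hS.sat_axLine]
    intro k h hk hh x y z hx hy hz
    obtain ⟨k, rfl⟩ := (iob_iff k).1 hk
    obtain ⟨h, rfl⟩ := (iob_iff h).1 hh
    obtain ⟨p, d, hp⟩ := exists_line k h
    obtain ⟨t, rfl⟩ := hp x hx
    obtain ⟨s, rfl⟩ := hp y hy
    obtain ⟨r, rfl⟩ := hp z hz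
    by_cases hts : s = t
    -- Here `x = y`, so the second alternative holds with `a = -1`.
    · refine ⟨-1, Or.inr fun i => ?_⟩
      simp [hts]
    · refine ⟨(r - t) / (s - t), Or.inl fun i => ?_⟩
      have : s - t ≠ 0 := sub_ne_zero.2 hts
      simp
      field_simp
  · refine hS.sat_axTriv _ _ fun A b t hA k hk => ?_
    obtain ⟨k, rfl⟩ := (iob_iff k).1 hk
    obtain ⟨g, hg⟩ := exists_trivial A b t hA
    -- Observers map coordinates to events, so the new coordinates `g x` require composition with
    -- `g⁻¹` on the right.
    refine ⟨.inl (k * g⁻¹), rfl, fun x y => ?_⟩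
    have h₁ : k.1 x = (k * g⁻¹).1 y ↔ y = g.1 x := by
      rw [show (k * g⁻¹).1 y = k.1 (g.1.symm y) from rfl, EmbeddingLike.apply_eq_iff_eq,
        eq_comm, ← g.1.injective.eq_iff, AffineEquiv.apply_symm_apply]
    rw [sameEv_iff, h₁, funext_iff, Fin.forall_fin_succ]
    simp only [(hg x).1, (hg x).2]
  · rw [Model.sat_axNoAcc]
    rintro _ b x ⟨g, rfl, -⟩
    rfl

/-- Left multiplication moves the events seen by an observer and all world-lines by the same `g`,
which cancels; the coordinates stay fixed because the frames are multiplied on the other side. -/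
theorem isAut (g : poincare) :
    minkowski.IsAut (Equiv.sumCongr (Equiv.mulLeft g) (Equiv.mulLeft g)) where
  iob k := by cases k <;> simp [minkowski]
  ph k := by cases k <;> simp [minkowski]
  wv k b x := by
    cases k with
    | inl k => cases b <;> simp [wv_inl, worldLine]
    | inr k => simp [minkowski]

/-- The Minkowski model has only two orbits of bodies under its automorphisms. -/
theorem exists_isAut (b : Fin 3 → poincare ⊕ poincare) :
    ∃ g, minkowski.IsAut g ∧ ∃ i j, i ≠ j ∧ g (b i) = b j := by
  -- Of three bodies two are of the same kind; if they are given by `u` and `v`, multiplication by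
  -- `v * u⁻¹` carries the first to the second.
  obtain ⟨i, j, hij, h⟩ := Fintype.exists_ne_map_eq_of_card_lt (fun i => (b i).isLeft) (by simp)
  rcases hi : b i with u | u <;> rcases hj : b j with v | v
  · exact ⟨_, isAut (v * u⁻¹), i, j, hij, by simp [hi, hj]⟩
  · simp [hi, hj] at h
  · simp [hi, hj] at h
  · exact ⟨_, isAut (v * u⁻¹), i, j, hij, by simp [hi, hj]⟩

end minkowski

end Kinematics

/-- There is no interpretation of classical kinematics in special relativity. -/
theorem mainTheorem5 :
    ¬ ∃ T : Kinematics.Translation,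
      Kinematics.IsInterpretation T Kinematics.ClassicalKinFull Kinematics.SpecRelFull := by
  rintro ⟨T, hT⟩
  obtain ⟨N, hN, hAut⟩ :=
    Kinematics.Translation.exists_model hT Kinematics.minkowski.sat_specRel
  obtain ⟨b, hb⟩ := Kinematics.Model.exists_inequivalent_bodies hN
  obtain ⟨g, hg, i, j, hij, h⟩ := Kinematics.minkowski.exists_isAut b
  exact hij (hb g (hAut g hg) i j h)
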